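/- For $R>0$ let $B(R)$ be the open disc of radius $R$ centred at the origin of $\mathbb R^2$, let $S=[-\tfrac12,\tfrac12]^2$, and let $$\Gamma_R=\{\lambda\in\mathbb Z^2:\ R-\tfrac1{\sqrt2}<\|\lambda\|<R+\tfrac1{\sqrt2}\},$$ which is finite and non-empty. For $\lambda\in\Gamma_R$ put $\mathcal A_R(\lambda)=\operatorname{Area}\big((\lambda+S)\cap B(R)\big)$. For real $r,\theta$ let $S_{r,\theta}$ be the square $S$ rotated by the angle $\theta$ about the origin and then shifted by the vector $(r,0)$, and put $$\mathcal A_\infty(r,\theta)=\operatorname{Area}\{(x,y)\in S_{r,\theta}:\ x\le 0\}.$$ Regard $\mathcal A_\infty=\mathcal A_\infty(r,\theta)$ as a random variable, with $(r,\theta)$ distributed uniformly on $[-\tfrac1{\sqrt2},\tfrac1{\sqrt2}]\times[0,2\pi)$. **Theorem.** (i) As $R\to\infty$ through the positive reals, the random variable $\mathcal A_R(\lambda)$, with $\lambda$ drawn uniformly from $\Gamma_R$ (that is, a uniformly random element of the collection $\Lambda_R=\{\mathcal A_R(\lambda)\}_{\lambda\in\Gamma_R}$, counted with multiplicity), converges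 in distribution to $\mathcal A_\infty$. (ii) $\operatorname{Var}(\mathcal A_\infty)=c_0$, where $$c_0=\frac14-\frac1{2\pi\sqrt2}\left(\frac4{15}+\frac{2\log(1+\sqrt2)}3+\frac{2\sqrt2}{15}\right).$$ -/

import Mathlib

open MeasureTheory ProbabilityTheory Filter

noncomputable section

/-- The unit square `[-1/2, 1/2]²` in the plane `ℝ × ℝ` (with its Lebesgue measure). -/
def unitSquare : Set (ℝ × ℝ) :=
  Set.Icc (-(1 / 2)) (1 / 2) ×ˢ Set.Icc (-(1 / 2)) (1 / 2)

/-- The Euclidean length of a vector of the plane (the norm of `ℝ × ℝ` is the sup norm). -/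
def euclLength (p : ℝ × ℝ) : ℝ := Real.sqrt (p.1 ^ 2 + p.2 ^ 2)

/-- The open disc of radius `R` centred at the origin. -/
def disc (R : ℝ) : Set (ℝ × ℝ) := {p | euclLength p < R}

/-- A lattice point regarded as a point of the plane. -/
def latticeToPlane (l : ℤ × ℤ) : ℝ × ℝ := ((l.1 : ℝ), (l.2 : ℝ))

/-- The lattice points in the open annulus `R - 1/√2 < ‖z‖ < R + 1/√2`. -/
def annulusLattice (R : ℝ) : Set (ℤ × ℤ) :=
  {l | R - 1 / Real.sqrt 2 < euclLength (latticeToPlane l) ∧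
    euclLength (latticeToPlane l) < R + 1 / Real.sqrt 2}

/-- The area of the part of the unit square centred at the lattice point `l` that lies in the
disc of radius `R`. -/
def areaInDisc (R : ℝ) (l : ℤ × ℤ) : ℝ :=
  volume.real (((fun p => latticeToPlane l + p) '' unitSquare) ∩ disc R)

/-- The rotation of the plane by the angle `θ`. -/
def tilt (θ : ℝ) (p : ℝ × ℝ) : ℝ × ℝ :=
  (Real.cos θ * p.1 - Real.sin θ * p.2, Real.sin θ * p.1 + Real.cos θ * p.2)

/-- The unit square rotated by `θ` and then shifted horizontally by `r`. -/
def tiltedSquare (r θ : ℝ) : Set (ℝ × ℝ) :=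
  (fun p => ((r, 0) : ℝ × ℝ) + p) '' (tilt θ '' unitSquare)

/-- The area of the part of the tilted and shifted square to the left of the vertical axis, as a
function of the pair `(r, θ)`. -/
def areaLeft (q : ℝ × ℝ) : ℝ :=
  volume.real (tiltedSquare q.1 q.2 ∩ {p | p.1 ≤ 0})

/-- The rectangle `[-1/√2, 1/√2] × [0, 2π)` of pairs `(r, θ)`. -/
def paramRect : Set (ℝ × ℝ) :=
  Set.Icc (-(1 / Real.sqrt 2)) (1 / Real.sqrt 2) ×ˢ Set.Ico 0 (2 * Real.pi)

/-- The uniform probability measure on the rectangle of pairs `(r, θ)`: normalized Lebesgue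
measure. -/
def paramUniform : Measure (ℝ × ℝ) := volume[|paramRect]

/-- The uniform probability measure on the lattice points in the annulus of radius `R > 0`. -/
def latticeUniform (R : Set.Ioi (0 : ℝ)) : Measure (ℤ × ℤ) := uniformOn (annulusLattice R)

/-- The limiting variance. -/
def limitVariance : ℝ :=
  1 / 4 - 1 / (2 * Real.pi * Real.sqrt 2) *
    (4 / 15 + 2 * Real.log (1 + Real.sqrt 2) / 3 + 2 * Real.sqrt 2 / 15)

theorem annulusLattice_finite (R : ℝ) : (annulusLattice R).Finite := by
  obtain ⟨N, hN⟩ := exists_nat_gt (R + 1 / Real.sqrt 2)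
  refine ((Set.finite_Icc (-(N : ℤ)) N).prod (Set.finite_Icc (-(N : ℤ)) N)).subset ?_
  rintro ⟨a, b⟩ ⟨-, h⟩
  have h1 : |(a : ℝ)| < N :=
    lt_of_le_of_lt (Real.abs_le_sqrt (le_add_of_nonneg_right (sq_nonneg (b : ℝ)))) (h.trans hN)
  have h2 : |(b : ℝ)| < N :=
    lt_of_le_of_lt (Real.abs_le_sqrt (le_add_of_nonneg_left (sq_nonneg (a : ℝ)))) (h.trans hN)
  rw [abs_lt] at h1 h2
  refine ⟨⟨?_, ?_⟩, ⟨?_, ?_⟩⟩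
  · exact_mod_cast h1.1.le
  · exact_mod_cast h1.2.le
  · exact_mod_cast h2.1.le
  · exact_mod_cast h2.2.le

theorem annulusLattice_nonempty {R : ℝ} (hR : 0 < R) : (annulusLattice R).Nonempty := by
  have hs : 1 / 2 < 1 / Real.sqrt 2 := by
    apply one_div_lt_one_div_of_lt (by positivity)
    rw [Real.sqrt_lt' (by norm_num)]
    norm_num
  have hn : (0 : ℝ) ≤ (⌊R + 1 / 2⌋ : ℝ) := by
    exact_mod_cast Int.floor_nonneg.mpr (by linarith)
  have hlen : euclLength (latticeToPlane (⌊R + 1 / 2⌋, 0)) = (⌊R + 1 / 2⌋ : ℝ) := by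
    have h : ((⌊R + 1 / 2⌋ : ℝ)) ^ 2 + ((0 : ℤ) : ℝ) ^ 2 = (⌊R + 1 / 2⌋ : ℝ) ^ 2 := by norm_num
    rw [euclLength, latticeToPlane, h, Real.sqrt_sq hn]
  have h1 := Int.floor_le (R + 1 / 2)
  have h2 := Int.lt_floor_add_one (R + 1 / 2)
  refine ⟨(⌊R + 1 / 2⌋, 0), ?_, ?_⟩ <;> rw [hlen] <;> linarith

instance instIsProbabilityMeasureLatticeUniform (R : Set.Ioi (0 : ℝ)) :
    IsProbabilityMeasure (latticeUniform R) :=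
  isProbabilityMeasure_uniformOn (annulusLattice_finite R) (annulusLattice_nonempty R.2)

theorem volume_paramRect :
    volume paramRect = ENNReal.ofReal (2 * (1 / Real.sqrt 2)) * ENNReal.ofReal (2 * Real.pi) := by
  rw [paramRect, Measure.volume_eq_prod, Measure.prod_prod, Real.volume_Icc, Real.volume_Ico]
  congr 2 <;> ring

instance instIsProbabilityMeasureParamUniform : IsProbabilityMeasure paramUniform := by
  refine cond_isProbabilityMeasure_of_finite ?_ ?_
  · rw [volume_paramRect]
    refine mul_ne_zero ?_ ?_ <;> simp [Real.pi_pos]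
  · rw [volume_paramRect]
    exact ENNReal.mul_ne_top ENNReal.ofReal_ne_top ENNReal.ofReal_ne_top

end

open Set Topology

/-! Near a lattice point `λ` at distance about `R` from the origin the circle is almost straight.
Hence the area of `λ + S` inside the disc is close, uniformly over the annulus, to the area
`halfArea r u` of the part of the square where `r + u · s ≤ 0`, with `r = ‖λ‖ - R` and `u` the
direction of `λ` (`eventually_abs_areaInDisc_sub_lt`). Up to a rotation and a reflection this is the
limiting area at `(r, θ)`. So (i) reduces to joint equidistribution of `(‖λ‖ - R, λ/‖λ‖)` for
lattice points near the circle (`tendsto_annulusSum`, and `tendsto_tsum_annulus` for the sharp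
annulus).

Equidistribution needs no exponential sums. The sum of `F (‖x‖ - R, x/‖x‖)` over the shifted lattice
`ℤ² + v`, averaged over `v` in a unit cell, is exactly an integral over the plane, which polar
coordinates evaluate as `R` times the expected limit plus a bounded term. It remains to see that a
shift changes the sum only by `o(R)` (`tendsto_annulusSum_sub`). For almost every direction `u` the
numbers `u · m`, `m ∈ ℤ²`, are dense, so some `m` has `u · (m - v)` tiny. Replacing the shift `v` by
`m` then hardly changes the distance to the origin of points in direction `u`, while a shift by `m`
does not change the lattice. As `m` depends on `u`, the directions are split by a continuous
partition of unity indexed by finitely many `m`; the uncovered part has small mean and is absorbed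
by a crude counting bound (`tsum_annulus_le`).

For (ii), `halfArea r u` is the probability that a random point `s` of the square has `u · s ≤ -r`,
and its square is the probability that the maximum of `u · s` and `u · s'` is at most `-r`, for
independent `s` and `s'`. Integrating over `r` leaves the mean of `|u · (s - s')|`
(`integral_halfArea_sq`). This is a fourth-order difference of `z ^ 4 * |z| / 120`
(`integral_abs_four`), and its integral over the angle is eight times an elementary integral over an
octant. -/

/-- The standard scalar product of the plane. -/
def dotProd (u s : ℝ × ℝ) : ℝ := u.1 * s.1 + u.2 * s.2

/-- The direction of a vector of the plane (zero for the zero vector). -/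
noncomputable def direction (x : ℝ × ℝ) : ℝ × ℝ := (x.1 / euclLength x, x.2 / euclLength x)

/-- The unit circle of the plane. -/
def planeCircle : Set (ℝ × ℝ) := {u | u.1 ^ 2 + u.2 ^ 2 = 1}

/-- The point of the unit circle with argument `θ`. -/
noncomputable def circlePoint (θ : ℝ) : ℝ × ℝ := (Real.cos θ, Real.sin θ)

/-! ### Euclidean length and direction under small shifts -/

section Geometry

theorem euclLength_nonneg (x : ℝ × ℝ) : 0 ≤ euclLength x := Real.sqrt_nonneg _

theorem euclLength_sq (x : ℝ × ℝ) : euclLength x ^ 2 = x.1 ^ 2 + x.2 ^ 2 :=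
  Real.sq_sqrt (by positivity)

theorem euclLength_eq_norm (x : ℝ × ℝ) : euclLength x = ‖(⟨x.1, x.2⟩ : ℂ)‖ := by
  rw [Complex.norm_def, Complex.normSq_apply, euclLength]
  congr 1; simp only; ring

theorem euclLength_add_le (x y : ℝ × ℝ) : euclLength (x + y) ≤ euclLength x + euclLength y := by
  simp only [euclLength_eq_norm]
  exact norm_add_le (⟨x.1, x.2⟩ : ℂ) ⟨y.1, y.2⟩

theorem euclLength_neg (x : ℝ × ℝ) : euclLength (-x) = euclLength x := by
  simp [euclLength]

theorem abs_euclLength_add_sub_le (x w : ℝ × ℝ) :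
    |euclLength (x + w) - euclLength x| ≤ euclLength w := by
  have h1 := euclLength_add_le x w
  have h2 := euclLength_add_le (x + w) (-w)
  rw [euclLength_neg, add_neg_cancel_right] at h2
  rw [abs_le]; constructor <;> linarith

theorem abs_fst_le_euclLength (x : ℝ × ℝ) : |x.1| ≤ euclLength x :=
  Real.abs_le_sqrt (le_add_of_nonneg_right (sq_nonneg _))

theorem abs_snd_le_euclLength (x : ℝ × ℝ) : |x.2| ≤ euclLength x :=
  Real.abs_le_sqrt (le_add_of_nonneg_left (sq_nonneg _))

theorem continuous_euclLength : Continuous euclLength := by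
  unfold euclLength; fun_prop

theorem euclLength_eq_zero {x : ℝ × ℝ} : euclLength x = 0 ↔ x = 0 := by
  constructor
  · intro h
    have h1 := abs_fst_le_euclLength x
    have h2 := abs_snd_le_euclLength x
    rw [h] at h1 h2
    ext <;> simp [abs_nonpos_iff.mp h1, abs_nonpos_iff.mp h2]
  · rintro rfl; simp [euclLength]

theorem direction_mem_planeCircle {x : ℝ × ℝ} (hx : 0 < euclLength x) :
    direction x ∈ planeCircle := by
  have := euclLength_sq x
  simp only [direction, planeCircle, mem_ofPred_eq]
  rw [div_pow, div_pow, ← add_div, ← this, div_self (by positivity)]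

theorem circlePoint_mem_planeCircle (θ : ℝ) : circlePoint θ ∈ planeCircle :=
  Real.cos_sq_add_sin_sq θ

theorem continuous_circlePoint : Continuous circlePoint := by
  unfold circlePoint; fun_prop

theorem planeCircle_subset_closedBall : planeCircle ⊆ Metric.closedBall 0 1 := by
  intro u hu
  have hu : u.1 ^ 2 + u.2 ^ 2 = 1 := hu
  rw [mem_closedBall_zero_iff, Prod.norm_def, max_le_iff]
  exact ⟨abs_le_one_iff_mul_self_le_one.mpr (by nlinarith [sq_nonneg u.2]),
    abs_le_one_iff_mul_self_le_one.mpr (by nlinarith [sq_nonneg u.1])⟩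

theorem isCompact_planeCircle : IsCompact planeCircle :=
  (isCompact_closedBall (0 : ℝ × ℝ) 1).of_isClosed_subset
    (isClosed_eq (by fun_prop) continuous_const) planeCircle_subset_closedBall

theorem abs_dotProd_le {u : ℝ × ℝ} (hu : u ∈ planeCircle) (s : ℝ × ℝ) :
    |dotProd u s| ≤ euclLength s := by
  have hu : u.1 ^ 2 + u.2 ^ 2 = 1 := hu
  refine Real.abs_le_sqrt ?_
  unfold dotProd
  nlinarith [sq_nonneg (u.1 * s.2 - u.2 * s.1)]

theorem dotProd_direction_self {x : ℝ × ℝ} (hx : 0 < euclLength x) :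
    dotProd (direction x) x = euclLength x := by
  have := euclLength_sq x
  simp only [dotProd, direction]
  field_simp
  linarith

theorem dotProd_add (u s t : ℝ × ℝ) : dotProd u (s + t) = dotProd u s + dotProd u t := by
  simp only [dotProd, Prod.fst_add, Prod.snd_add]; ring

theorem dotProd_sub (u s t : ℝ × ℝ) : dotProd u (s - t) = dotProd u s - dotProd u t := by
  simp only [dotProd, Prod.fst_sub, Prod.snd_sub]; ring

/-- Cauchy–Schwarz for `x + w` against the unit vector in direction `x`. -/
theorem add_dotProd_le_euclLength_add {x : ℝ × ℝ} (hx : 0 < euclLength x) (w : ℝ × ℝ) :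
    euclLength x + dotProd (direction x) w ≤ euclLength (x + w) := by
  have := (le_abs_self _).trans (abs_dotProd_le (direction_mem_planeCircle hx) (x + w))
  rwa [dotProd_add, dotProd_direction_self hx] at this

/-- The right side equals `(‖x + w‖² + ‖x‖²) / (2‖x‖)`, so the bound is the inequality between
arithmetic and geometric means. With the preceding lower bound it gives the first-order expansion of
the length. -/
theorem euclLength_add_le_dotProd {x : ℝ × ℝ} (hx : 0 < euclLength x) (w : ℝ × ℝ) :
    euclLength (x + w) ≤
      euclLength x + dotProd (direction x) w + euclLength w ^ 2 / (2 * euclLength x) := by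
  have h1 := euclLength_sq x
  have h2 := euclLength_sq (x + w)
  have h3 := euclLength_sq w
  have h4 : dotProd (direction x) w * euclLength x = x.1 * w.1 + x.2 * w.2 := by
    simp only [dotProd, direction]; field_simp
  simp only [Prod.fst_add, Prod.snd_add] at h2
  have : euclLength x + dotProd (direction x) w + euclLength w ^ 2 / (2 * euclLength x)
      = (euclLength (x + w) ^ 2 + euclLength x ^ 2) / (2 * euclLength x) := by
    field_simp
    nlinarith
  rw [this, le_div_iff₀ (by positivity)]
  nlinarith [sq_nonneg (euclLength (x + w) - euclLength x)]

theorem abs_euclLength_add_sub_dotProd_le {x : ℝ × ℝ} (hx : 0 < euclLength x) (w : ℝ × ℝ) :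
    |euclLength (x + w) - euclLength x - dotProd (direction x) w| ≤
      euclLength w ^ 2 / (2 * euclLength x) := by
  have h1 := add_dotProd_le_euclLength_add hx w
  have h2 := euclLength_add_le_dotProd hx w
  have h3 : 0 ≤ euclLength w ^ 2 / (2 * euclLength x) := by positivity
  rw [abs_le]; constructor <;> linarith

theorem dist_direction_add_le {x : ℝ × ℝ} (hx : 0 < euclLength x) (w : ℝ × ℝ) :
    dist (direction (x + w)) (direction x) ≤ 2 * euclLength w / euclLength x := by
  have key : ∀ a b n n' l : ℝ, 0 < n → |a + b| ≤ n' → |b| ≤ l → |n' - n| ≤ l →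
      |(a + b) / n' - a / n| ≤ 2 * l / n := by
    intro a b n n' l hn h1 h2 h3
    have hn' : 0 ≤ n' := (abs_nonneg _).trans h1
    obtain ⟨q, hq⟩ : ∃ q, q = (a + b) / n' := ⟨_, rfl⟩
    have hq1 : |q| ≤ 1 := by
      rw [hq, abs_div, abs_of_nonneg hn']; exact div_le_one_of_le₀ h1 hn'
    -- If `n' = 0` then `a + b = 0` as well, so the identity survives the default value of division
    -- by zero.
    have hq2 : q * n' = a + b := by
      rcases hn'.eq_or_lt with h | h
      · rw [← h] at h1 ⊢
        simpa using (abs_nonpos_iff.mp h1).symm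
      · rw [hq]; field_simp
    have : q - a / n = (q * (n - n') + b) / n := by
      field_simp; linarith
    rw [← hq, this, abs_div, abs_of_pos hn]
    gcongr
    calc |q * (n - n') + b| ≤ |q| * |n - n'| + |b| := by
          rw [← abs_mul]; exact abs_add_le _ _
      _ ≤ 1 * l + l := by
          gcongr
          rwa [abs_sub_comm]
      _ = 2 * l := by ring
  have h := abs_euclLength_add_sub_le x w
  rw [Prod.dist_eq, max_le_iff]
  exact ⟨key _ _ _ _ _ hx (abs_fst_le_euclLength (x + w)) (abs_fst_le_euclLength w) h,
    key _ _ _ _ _ hx (abs_snd_le_euclLength (x + w)) (abs_snd_le_euclLength w) h⟩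

theorem continuousOn_direction : ContinuousOn direction {0}ᶜ := by
  have h : ∀ x ∈ ({0}ᶜ : Set (ℝ × ℝ)), euclLength x ≠ 0 :=
    fun x hx => fun h => hx (euclLength_eq_zero.mp h)
  exact (continuousOn_fst.div continuous_euclLength.continuousOn h).prodMk
    (continuousOn_snd.div continuous_euclLength.continuousOn h)

theorem measurable_direction : Measurable direction :=
  measurable_of_continuousOn_compl_singleton 0 continuousOn_direction

end Geometry

/-! ### Annular integrals in polar coordinates -/

section Polar

theorem euclLength_polarCoord_symm {p : ℝ × ℝ} (hp : 0 < p.1) :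
    euclLength (polarCoord.symm p) = p.1 := by
  rw [polarCoord_symm_apply, euclLength]
  rw [show (p.1 * Real.cos p.2) ^ 2 + (p.1 * Real.sin p.2) ^ 2 =
    p.1 ^ 2 * (Real.cos p.2 ^ 2 + Real.sin p.2 ^ 2) by ring, Real.cos_sq_add_sin_sq, mul_one,
    Real.sqrt_sq hp.le]

theorem direction_polarCoord_symm {p : ℝ × ℝ} (hp : 0 < p.1) :
    direction (polarCoord.symm p) = circlePoint p.2 := by
  rw [direction, euclLength_polarCoord_symm hp, polarCoord_symm_apply, circlePoint]
  simp only
  rw [mul_div_cancel_left₀ _ hp.ne', mul_div_cancel_left₀ _ hp.ne']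

/-- Integration of a function of `‖x‖ - R` and the direction of `x` in polar coordinates. -/
theorem integral_annulus_eq {H : ℝ × (ℝ × ℝ) → ℝ} {W R : ℝ}
    (hH : ∀ r u, W < |r| → H (r, u) = 0) (hR0 : 0 < R) (hR : W < R) :
    ∫ x, H (euclLength x - R, direction x) =
      ∫ p in univ ×ˢ Ioo (-Real.pi) Real.pi, (R + p.1) * H (p.1, circlePoint p.2) := by
  rw [← integral_comp_polarCoord_symm]
  have h1 : ∫ p in polarCoord.target, p.1 • H (euclLength (polarCoord.symm p) - R,
        direction (polarCoord.symm p)) =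
      ∫ p in univ ×ˢ Ioo (-Real.pi) Real.pi, p.1 * H (p.1 - R, circlePoint p.2) := by
    rw [← integral_indicator polarCoord.open_target.measurableSet,
      ← integral_indicator (MeasurableSet.univ.prod measurableSet_Ioo)]
    congr 1
    ext p
    by_cases hp : 0 < p.1
    · by_cases hq : p.2 ∈ Ioo (-Real.pi) Real.pi
      · rw [indicator_of_mem (by exact ⟨hp, hq⟩), indicator_of_mem (by exact ⟨mem_univ _, hq⟩),
          euclLength_polarCoord_symm hp, direction_polarCoord_symm hp, smul_eq_mul]
      · rw [indicator_of_notMem (by exact fun h => hq h.2),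
          indicator_of_notMem (by exact fun h => hq h.2)]
    · rw [indicator_of_notMem (by exact fun h => hp h.1)]
      symm
      -- Polar coordinates only reach positive radii, but for `p.1 ≤ 0` one has `|p.1 - R| ≥ R > W`,
      -- so the integral over all radii gains nothing.
      refine indicator_apply_eq_zero.mpr fun _ => ?_
      rw [hH, mul_zero]
      rw [abs_of_nonpos (by linarith)]; linarith
  rw [h1, ← integral_indicator (MeasurableSet.univ.prod measurableSet_Ioo),
    ← integral_indicator (MeasurableSet.univ.prod measurableSet_Ioo),
    ← integral_add_left_eq_self _ ((R, 0) : ℝ × ℝ)]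
  congr 1
  ext p
  simp [indicator]

end Polar

/-! ### Tiling by unit cells and a crude count of lattice points -/

/-- The half-open unit cell `[0, 1)²`. -/
def unitCell : Set (ℝ × ℝ) := Ico 0 1 ×ˢ Ico 0 1

section Tiling

theorem measurableSet_unitCell : MeasurableSet unitCell :=
  measurableSet_Ico.prod measurableSet_Ico

theorem volume_unitCell : volume unitCell = 1 := by
  rw [unitCell, Measure.volume_eq_prod, Measure.prod_prod]; simp

theorem volume_real_unitCell : volume.real unitCell = 1 := by
  rw [measureReal_def, volume_unitCell]; simp

theorem euclLength_le_two {s : ℝ × ℝ} (hs : s ∈ unitCell) : euclLength s ≤ 2 := by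
  obtain ⟨⟨h1, h2⟩, h3, h4⟩ := hs
  rw [euclLength, Real.sqrt_le_left (by norm_num)]
  nlinarith

/-- The lattice translates of the half-open cell tile the plane. -/
theorem hasSum_integral_unitCell {f : ℝ × ℝ → ℝ} (hf : Integrable f) :
    HasSum (fun l : ℤ × ℤ => ∫ s in unitCell, f (latticeToPlane l + s)) (∫ x, f x) := by
  have hU : ⋃ l : ℤ × ℤ, (fun s => latticeToPlane l + s) '' unitCell = univ := by
    refine eq_univ_of_forall fun x => mem_iUnion.mpr ⟨(⌊x.1⌋, ⌊x.2⌋), x - latticeToPlane _, ?_,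
      add_sub_cancel _ _⟩
    simp only [unitCell, latticeToPlane, mem_prod, Prod.fst_sub, Prod.snd_sub, mem_Ico]
    have h1 := Int.floor_le x.1
    have h2 := Int.lt_floor_add_one x.1
    have h3 := Int.floor_le x.2
    have h4 := Int.lt_floor_add_one x.2
    exact ⟨⟨by linarith, by linarith⟩, by linarith, by linarith⟩
  have hemb : ∀ l : ℤ × ℤ, MeasurableEmbedding fun s : ℝ × ℝ => latticeToPlane l + s :=
    fun l => measurableEmbedding_addLeft _
  have hd : Pairwise (Function.onFun Disjoint
      fun l : ℤ × ℤ => (fun s => latticeToPlane l + s) '' unitCell) := by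
    intro l m hlm
    refine disjoint_left.mpr ?_
    rintro _ ⟨s, ⟨⟨h1, h2⟩, h3, h4⟩, rfl⟩ ⟨t, ⟨⟨h5, h6⟩, h7, h8⟩, h⟩
    refine hlm (Prod.ext ?_ ?_)
    · have h := congrArg Prod.fst h
      simp only [latticeToPlane, Prod.fst_add] at h
      have e1 : (l.1 : ℝ) < m.1 + 1 := by linarith
      have e2 : (m.1 : ℝ) < l.1 + 1 := by linarith
      norm_cast at e1 e2; omega
    · have h := congrArg Prod.snd h
      simp only [latticeToPlane, Prod.snd_add] at h
      have e1 : (l.2 : ℝ) < m.2 + 1 := by linarith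
      have e2 : (m.2 : ℝ) < l.2 + 1 := by linarith
      norm_cast at e1 e2; omega
  have := hasSum_integral_iUnion (fun l => (hemb l).measurableSet_image.mpr measurableSet_unitCell)
    hd (f := f) (μ := volume) (by rw [hU]; exact hf.integrableOn)
  rw [hU, setIntegral_univ] at this
  have e : (fun l : ℤ × ℤ => ∫ s in unitCell, f (latticeToPlane l + s)) =
      fun l => ∫ x in (fun s => latticeToPlane l + s) '' unitCell, f x := funext fun l =>
    ((measurePreserving_add_left volume (latticeToPlane l)).setIntegral_image_emb
      (hemb l) f unitCell).symm
  rw [e]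
  exact this

theorem finite_setOf_euclLength_le (v : ℝ × ℝ) (B : ℝ) :
    {l : ℤ × ℤ | euclLength (latticeToPlane l + v) ≤ B}.Finite := by
  refine ((Set.finite_Icc ⌊-B - v.1⌋ ⌈B - v.1⌉).prod
    (Set.finite_Icc ⌊-B - v.2⌋ ⌈B - v.2⌉)).subset ?_
  intro l (hl : _ ≤ B)
  have h1 := abs_le.mp ((abs_fst_le_euclLength _).trans hl)
  have h2 := abs_le.mp ((abs_snd_le_euclLength _).trans hl)
  simp only [latticeToPlane, Prod.fst_add, Prod.snd_add] at h1 h2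
  refine ⟨⟨?_, ?_⟩, ⟨?_, ?_⟩⟩
  · exact_mod_cast (Int.floor_le _).trans (by linarith : -B - v.1 ≤ l.1)
  · exact_mod_cast (by linarith : (l.1 : ℝ) ≤ B - v.1).trans (Int.le_ceil _)
  · exact_mod_cast (Int.floor_le _).trans (by linarith : -B - v.2 ≤ l.2)
  · exact_mod_cast (by linarith : (l.2 : ℝ) ≤ B - v.2).trans (Int.le_ceil _)

theorem finite_setOf_abs_euclLength_sub_le (v : ℝ × ℝ) (R K : ℝ) :
    {l : ℤ × ℤ | |euclLength (latticeToPlane l + v) - R| ≤ K}.Finite :=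
  (finite_setOf_euclLength_le v (R + K)).subset fun l (hl : |_| ≤ K) => by
    have := (abs_le.mp hl).2
    show euclLength _ ≤ _
    linarith

theorem summable_of_annulus {f : ℤ × ℤ → ℝ} (v : ℝ × ℝ) (R K : ℝ)
    (hf : ∀ l, K < |euclLength (latticeToPlane l + v) - R| → f l = 0) : Summable f :=
  summable_of_hasFiniteSupport ((finite_setOf_abs_euclLength_sub_le v R K).subset fun l hl => by
    by_contra h
    exact hl (hf l (not_le.mp h)))

theorem isCompact_annulus (R K : ℝ) : IsCompact {x | |euclLength x - R| ≤ K} := by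
  refine (isCompact_closedBall (0 : ℝ × ℝ) (R + K)).of_isClosed_subset
    (isClosed_le (by have := continuous_euclLength; fun_prop) continuous_const) ?_
  intro x (hx : |_| ≤ K)
  have := (abs_le.mp hx).2
  rw [mem_closedBall_zero_iff, Prod.norm_def, max_le_iff]
  exact ⟨(abs_fst_le_euclLength x).trans (by linarith),
    (abs_snd_le_euclLength x).trans (by linarith)⟩

theorem integrable_of_annulus {f : ℝ × ℝ → ℝ} (hf : Measurable f) {R K C : ℝ}
    (h0 : ∀ x, K < |euclLength x - R| → f x = 0) (hC : ∀ x, |f x| ≤ C) : Integrable f := by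
  have h : IntegrableOn f {x | |euclLength x - R| ≤ K} :=
    Measure.integrableOn_of_bounded (isCompact_annulus R K).measure_lt_top.ne
      hf.aestronglyMeasurable (ae_of_all _ hC)
  rwa [integrableOn_iff_integrable_of_support_subset] at h
  intro x hx
  by_contra h
  exact hx (h0 x (not_le.mp h))

theorem exists_abs_sub_lt_of_continuousOn {g : ℝ × ℝ → ℝ} {s : Set (ℝ × ℝ)} (hs : IsCompact s)
    (hg : ContinuousOn g s) {τ : ℝ} (hτ : 0 < τ) :
    ∃ δ > 0, ∀ u ∈ s, ∀ u' ∈ s, dist u u' < δ → |g u - g u'| < τ := by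
  have := Metric.uniformContinuousOn_iff.mp (hs.uniformContinuousOn_of_continuous hg) τ hτ
  simpa only [Real.dist_eq] using this

theorem pos_euclLength_of_abs_sub_le {x : ℝ × ℝ} {R K : ℝ} (h : |euclLength x - R| ≤ K)
    (hR : K < R) : 0 < euclLength x := by
  have := (abs_le.mp h).1
  linarith

/-- The number of translated lattice points in an annulus of bounded width, weighted by a function
of the direction, is at most a constant times the radius times the mean of the weight. -/
theorem tsum_annulus_le {d : ℝ × ℝ → ℝ} (hd : Continuous d) (hd0 : ∀ u, 0 ≤ d u) {K : ℝ}
    (hK : 0 ≤ K) (v : ℝ × ℝ) {δ : ℝ} (hδ : 0 < δ) :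
    ∀ᶠ R in atTop, ∑' l : ℤ × ℤ, (if |euclLength (latticeToPlane l + v) - R| ≤ K then
        d (direction (latticeToPlane l + v)) else 0) ≤
      R * (2 * (K + 2) * ((∫ θ in Ioo (-Real.pi) Real.pi, d (circlePoint θ)) +
        2 * Real.pi * δ)) := by
  obtain ⟨η, hη, hη'⟩ := exists_abs_sub_lt_of_continuousOn isCompact_planeCircle
    hd.continuousOn hδ
  obtain ⟨C, hC⟩ := (isCompact_closedBall (0 : ℝ × ℝ) 1).exists_bound_of_continuousOn
    hd.continuousOn
  -- A point `x` of the annulus then has length above `4 / η`, so a shift within the cell, of length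
  -- at most 2, turns its direction by less than `η`.
  filter_upwards [eventually_gt_atTop (K + 4 + 4 / η)] with R hR
  have hη4 : 0 < 4 / η := by positivity
  -- The annulus is widened by the bound 2 on the cell and the weight raised by `δ`, so that each
  -- lattice summand is at most the integral of `H` over its cell.
  set H : ℝ × (ℝ × ℝ) → ℝ := fun p => if |p.1| ≤ K + 2 then d p.2 + δ else 0 with hH
  have hH0 : ∀ p, 0 ≤ H p := by
    intro p; simp only [hH]; split_ifs
    · have := hd0 p.2; positivity
    · rfl
  have hmeas : Measurable fun x => H (euclLength x - R, direction x) := by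
    have h1 := continuous_euclLength.measurable
    have h2 := hd.measurable.comp measurable_direction
    refine Measurable.ite ?_ (h2.add_const δ) measurable_const
    exact measurableSet_le (by fun_prop) measurable_const
  have hdir : ∀ x, direction x ∈ Metric.closedBall (0 : ℝ × ℝ) 1 := by
    intro x
    rcases (euclLength_nonneg x).eq_or_lt with h | h
    · rw [direction, ← h]; simp
    · exact planeCircle_subset_closedBall (direction_mem_planeCircle h)
  have hbound : ∀ x, |H (euclLength x - R, direction x)| ≤ C + δ := by
    intro x
    have h1 := hC _ (hdir x)
    rw [Real.norm_eq_abs] at h1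
    have h2 := le_abs_self (d (direction x))
    rw [abs_of_nonneg (hH0 _)]
    simp only [hH]; split_ifs
    · linarith
    · have := abs_nonneg (d (direction x)); linarith
  have hint : Integrable fun x => H (euclLength x - R, direction x) :=
    integrable_of_annulus hmeas (R := R) (K := K + 2)
      (fun x hx => if_neg (not_le.mpr hx)) hbound
  have hint' : Integrable fun x => H (euclLength (x + v) - R, direction (x + v)) :=
    hint.comp_add_right v
  have hsum := hasSum_integral_unitCell hint'
  have hle : ∀ l : ℤ × ℤ, (if |euclLength (latticeToPlane l + v) - R| ≤ K then
      d (direction (latticeToPlane l + v)) else 0) ≤ ∫ s in unitCell,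
        H (euclLength (latticeToPlane l + s + v) - R, direction (latticeToPlane l + s + v)) := by
    intro l
    split_ifs with h
    · have hx := pos_euclLength_of_abs_sub_le h (by linarith)
      set x := latticeToPlane l + v with hxdef
      have hxR := (abs_le.mp h).1
      calc d (direction x) = ∫ s in unitCell, d (direction x) := by
            rw [setIntegral_const, volume_real_unitCell, one_smul]
        _ ≤ _ := by
            refine setIntegral_mono_on (by simp [volume_unitCell]) ?_ measurableSet_unitCell ?_
            · exact (hint'.comp_add_left (latticeToPlane l)).integrableOn
            · intro s hs
              rw [show latticeToPlane l + s + v = x + s by rw [hxdef]; abel]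
              have hs2 := euclLength_le_two hs
              have h1 := abs_euclLength_add_sub_le x s
              have h2 : |euclLength (x + s) - R| ≤ K + 2 := by
                calc _ = |(euclLength x - R) + (euclLength (x + s) - euclLength x)| := by ring_nf
                  _ ≤ _ := (abs_add_le _ _).trans (by linarith)
              have h3 := pos_euclLength_of_abs_sub_le h2 (by linarith)
              have h4 : dist (direction (x + s)) (direction x) < η := by
                refine (dist_direction_add_le hx s).trans_lt ?_
                rw [div_lt_iff₀ hx]
                have : 4 / η < euclLength x := by linarith
                rw [div_lt_iff₀ hη] at this
                linarith
              have h5 := abs_lt.mp (hη' _ (direction_mem_planeCircle h3) _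
                (direction_mem_planeCircle hx) h4)
              simp only [hH, if_pos h2]
              linarith
    · exact integral_nonneg fun s => hH0 _
  have hsummable : Summable fun l : ℤ × ℤ => (if |euclLength (latticeToPlane l + v) - R| ≤ K then
      d (direction (latticeToPlane l + v)) else 0) :=
    summable_of_annulus v R K fun l hl => if_neg (not_le.mpr hl)
  refine (hsummable.tsum_le_tsum hle hsum.summable).trans ?_
  rw [hsum.tsum_eq, integral_add_right_eq_self (fun x => H (euclLength x - R, direction x)) v,
    integral_annulus_eq (W := K + 2) (fun r u hr => if_neg (not_le.mpr hr)) (by linarith)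
      (by linarith)]
  have hfac : ∀ p : ℝ × ℝ, (R + p.1) * H (p.1, circlePoint p.2) =
      ((Icc (-(K + 2)) (K + 2)).indicator (fun r => R + r) p.1) * (d (circlePoint p.2) + δ) := by
    intro p
    simp only [hH, indicator, mem_Icc, ← abs_le]
    split_ifs <;> simp
  simp_rw [hfac]
  rw [Measure.volume_eq_prod, setIntegral_prod_mul (fun r => (Icc (-(K + 2)) (K + 2)).indicator
    (fun r => R + r) r) (fun θ => d (circlePoint θ) + δ), setIntegral_univ,
    integral_indicator measurableSet_Icc, integral_Icc_eq_integral_Ioc,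
    ← intervalIntegral.integral_of_le (by linarith)]
  have hdint : IntegrableOn (fun θ => d (circlePoint θ)) (Ioo (-Real.pi) Real.pi) :=
    ((hd.comp continuous_circlePoint).integrableOn_Icc).mono_set Ioo_subset_Icc_self
  rw [integral_add hdint (by simp), setIntegral_const, intervalIntegral.integral_add (by simp)
    (by simp), intervalIntegral.integral_const, integral_id]
  have : volume.real (Ioo (-Real.pi) Real.pi) = 2 * Real.pi := by
    rw [Real.volume_real_Ioo_of_le (by linarith [Real.pi_pos])]; ring
  rw [this]
  simp only [smul_eq_mul]
  apply le_of_eq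
  ring

end Tiling

/-! ### Dense projections of the lattice and a partition of unity in the direction -/

section Density

/-- For almost every direction, the scalar products of the direction with the lattice points are
dense in the line. -/
theorem ae_exists_abs_dotProd_lt :
    ∀ᵐ θ ∂(volume.restrict (Ioo (-Real.pi) Real.pi)), ∀ v : ℝ × ℝ, ∀ ε > 0,
      ∃ m : ℤ × ℤ, |dotProd (circlePoint θ) (latticeToPlane m - v)| < ε := by
  have hc : (range fun p : ℤ × ℤ => Complex.arg ((p.1 : ℂ) + p.2 * Complex.I)).Countable :=
    countable_range _
  filter_upwards [ae_restrict_of_ae (hc.ae_notMem volume),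
    ae_restrict_mem measurableSet_Ioo] with θ hθ hθ' v ε hε
  -- The projections of `ℤ²` form the group generated by `cos θ` and `sin θ`. If it is cyclic, `cos
  -- θ` and `sin θ` are integer multiples of one number, so `θ` is the argument of a Gaussian
  -- integer, and these arguments are countably many.
  rcases AddSubgroup.dense_or_cyclic (AddSubgroup.closure {Real.cos θ, Real.sin θ}) with h | ⟨a, h⟩
  · obtain ⟨g, hg, hgd⟩ := h.exists_dist_lt (dotProd (circlePoint θ) v) hε
    obtain ⟨m, n, rfl⟩ := AddSubgroup.mem_closure_pair.mp hg
    refine ⟨(m, n), ?_⟩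
    rw [dist_comm, Real.dist_eq] at hgd
    rw [dotProd_sub]
    convert hgd using 3
    simp only [dotProd, circlePoint, latticeToPlane, zsmul_eq_mul]
    ring
  · exfalso
    obtain ⟨p, hp⟩ := AddSubgroup.mem_closure_singleton.mp
      (h ▸ AddSubgroup.subset_closure (by simp) : Real.cos θ ∈ AddSubgroup.closure {a})
    obtain ⟨q, hq⟩ := AddSubgroup.mem_closure_singleton.mp
      (h ▸ AddSubgroup.subset_closure (by simp) : Real.sin θ ∈ AddSubgroup.closure {a})
    have harg := Complex.arg_cos_add_sin_mul_I (θ := θ) ⟨hθ'.1, hθ'.2.le⟩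
    rw [← Complex.ofReal_cos, ← Complex.ofReal_sin, ← hp, ← hq] at harg
    simp only [zsmul_eq_mul] at harg
    rcases lt_trichotomy a 0 with ha | rfl | ha
    · refine hθ ⟨(-p, -q), ?_⟩
      refine ((Complex.arg_real_mul _ (neg_pos.mpr ha)).symm.trans ?_).trans harg
      congr 1; push_cast; ring
    · have := Real.cos_sq_add_sin_sq θ
      rw [← hp, ← hq] at this
      simp at this
    · refine hθ ⟨(p, q), ?_⟩
      refine ((Complex.arg_real_mul _ ha).symm.trans ?_).trans harg
      congr 1; push_cast; ring

/-- The square box of lattice points with coordinates at most `M` in absolute value. -/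
noncomputable def latticeBox (M : ℕ) : Finset (ℤ × ℤ) := Finset.Icc (-(M : ℤ)) M ×ˢ Finset.Icc (-(M : ℤ)) M

/-- The weight of the lattice point `m`, positive where `u · (m - v)` is smaller than `ε`. -/
noncomputable def nearWeight (ε : ℝ) (v : ℝ × ℝ) (m : ℤ × ℤ) (u : ℝ × ℝ) : ℝ :=
  max 0 (ε - |dotProd u (latticeToPlane m - v)|)

/-- The denominator of the normalized weights. -/
noncomputable def weightTotal (ε : ℝ) (v : ℝ × ℝ) (M : ℕ) (u : ℝ × ℝ) : ℝ :=
  1 / ((M : ℝ) + 1) + ∑ m ∈ latticeBox M, nearWeight ε v m u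

/-- The normalized weight of a lattice point. -/
noncomputable def normWeight (ε : ℝ) (v : ℝ × ℝ) (M : ℕ) (m : ℤ × ℤ) (u : ℝ × ℝ) : ℝ :=
  nearWeight ε v m u / weightTotal ε v M u

/-- The part of the unit mass that the normalized weights leave out. -/
noncomputable def weightDefect (ε : ℝ) (v : ℝ × ℝ) (M : ℕ) (u : ℝ × ℝ) : ℝ :=
  1 / ((M : ℝ) + 1) / weightTotal ε v M u

variable (ε : ℝ) (v : ℝ × ℝ) (M : ℕ) (m : ℤ × ℤ)

theorem nearWeight_nonneg (u : ℝ × ℝ) : 0 ≤ nearWeight ε v m u := le_max_left _ _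

theorem continuous_nearWeight : Continuous (nearWeight ε v m) := by
  unfold nearWeight dotProd; fun_prop

/-- The summand `1 / (M + 1)` keeps the denominator positive in directions where no lattice point of
the box is suitable. This makes the normalized weights continuous everywhere, at the price of the
defect. -/
theorem weightTotal_pos (u : ℝ × ℝ) : 0 < weightTotal ε v M u :=
  add_pos_of_pos_of_nonneg (by positivity)
    (Finset.sum_nonneg fun m _ => nearWeight_nonneg ε v m u)

theorem continuous_weightTotal : Continuous (weightTotal ε v M) :=
  continuous_const.add (continuous_finsetSum _ fun m _ => continuous_nearWeight ε v m)

theorem continuous_normWeight : Continuous (normWeight ε v M m) :=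
  (continuous_nearWeight ε v m).div (continuous_weightTotal ε v M)
    fun u => (weightTotal_pos ε v M u).ne'

theorem continuous_weightDefect : Continuous (weightDefect ε v M) :=
  continuous_const.div (continuous_weightTotal ε v M) fun u => (weightTotal_pos ε v M u).ne'

theorem normWeight_nonneg (u : ℝ × ℝ) : 0 ≤ normWeight ε v M m u :=
  div_nonneg (nearWeight_nonneg ε v m u) (weightTotal_pos ε v M u).le

theorem weightDefect_nonneg (u : ℝ × ℝ) : 0 ≤ weightDefect ε v M u :=
  div_nonneg (by positivity) (weightTotal_pos ε v M u).le

theorem sum_normWeight_add_weightDefect (u : ℝ × ℝ) :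
    ∑ m ∈ latticeBox M, normWeight ε v M m u + weightDefect ε v M u = 1 := by
  simp only [normWeight, weightDefect, ← Finset.sum_div]
  rw [← add_div, add_comm, ← weightTotal, div_self (weightTotal_pos ε v M u).ne']

theorem abs_dotProd_lt_of_normWeight_ne_zero {u : ℝ × ℝ} (h : normWeight ε v M m u ≠ 0) :
    |dotProd u (latticeToPlane m - v)| < ε := by
  by_contra h'
  refine h ?_
  rw [normWeight, nearWeight, max_eq_left (by linarith [not_lt.mp h']), zero_div]

theorem sum_normWeight_le_one (u : ℝ × ℝ) : ∑ m ∈ latticeBox M, normWeight ε v M m u ≤ 1 := by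
  linarith [sum_normWeight_add_weightDefect ε v M u, weightDefect_nonneg ε v M u]

theorem weightDefect_le_one (u : ℝ × ℝ) : weightDefect ε v M u ≤ 1 := by
  linarith [sum_normWeight_add_weightDefect ε v M u,
    Finset.sum_nonneg fun m (_ : m ∈ latticeBox M) => normWeight_nonneg ε v M m u]

/-- In almost every direction some `m` has near weight at least some `c > 0`. Once the box contains
`m` the defect is at most `1 / ((M + 1) c)`. Dominated convergence with bound 1 applies. -/
theorem tendsto_integral_weightDefect {ε : ℝ} (hε : 0 < ε) :
    Tendsto (fun M => ∫ θ in Ioo (-Real.pi) Real.pi, weightDefect ε v M (circlePoint θ)) atTop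
      (𝓝 0) := by
  rw [← integral_zero ℝ ℝ (μ := volume.restrict (Ioo (-Real.pi) Real.pi))]
  refine tendsto_integral_of_dominated_convergence (fun _ => 1) ?_ (by simp) ?_ ?_
  · intro M
    exact ((continuous_weightDefect ε v M).comp continuous_circlePoint).aestronglyMeasurable
  · intro M
    refine ae_of_all _ fun θ => ?_
    rw [Real.norm_eq_abs, abs_of_nonneg (weightDefect_nonneg ε v M _)]
    exact weightDefect_le_one ε v M _
  · filter_upwards [ae_exists_abs_dotProd_lt] with θ hθ
    obtain ⟨m, hm⟩ := hθ v ε hε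
    set c := ε - |dotProd (circlePoint θ) (latticeToPlane m - v)| with hc
    have hc0 : 0 < c := by linarith
    have h0 : Tendsto (fun M : ℕ => 1 / ((M : ℝ) + 1) / c) atTop (𝓝 0) := by
      simpa using tendsto_one_div_add_atTop_nhds_zero_nat.div_const c
    refine squeeze_zero' (Eventually.of_forall fun M => weightDefect_nonneg ε v M _) ?_ h0
    filter_upwards [eventually_ge_atTop (max m.1.natAbs m.2.natAbs)] with M hM
    have h1 : m ∈ latticeBox M := by
      simp only [latticeBox, Finset.mem_product, Finset.mem_Icc]
      have := (le_max_left _ _).trans hM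
      have := (le_max_right _ _).trans hM
      omega
    have h2 : c ≤ weightTotal ε v M (circlePoint θ) := by
      have h3 := Finset.single_le_sum
        (fun m _ => nearWeight_nonneg ε v m (circlePoint θ)) h1
      have h4 : c ≤ nearWeight ε v m (circlePoint θ) := le_max_right _ _
      have h5 : (0 : ℝ) ≤ 1 / ((M : ℝ) + 1) := by positivity
      rw [weightTotal]; linarith
    unfold weightDefect
    gcongr

end Density

/-! ### Effect of a single shift on annular sums -/

/-- The sum of `F (‖x‖ - R, direction x)` over the points `x` of the lattice shifted by `v`. -/
noncomputable def annulusSum (F : ℝ × (ℝ × ℝ) → ℝ) (R : ℝ) (v : ℝ × ℝ) : ℝ :=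
  ∑' l : ℤ × ℤ, F (euclLength (latticeToPlane l + v) - R, direction (latticeToPlane l + v))

section Shift

variable {F : ℝ × (ℝ × ℝ) → ℝ} {W : ℝ}

theorem summable_annulusSum (hW : ∀ r u, W < |r| → F (r, u) = 0) (R : ℝ) (v : ℝ × ℝ) :
    Summable fun l : ℤ × ℤ =>
      F (euclLength (latticeToPlane l + v) - R, direction (latticeToPlane l + v)) :=
  summable_of_annulus v R W fun _ hl => hW _ _ hl

theorem latticeToPlane_add (l m : ℤ × ℤ) :
    latticeToPlane (l + m) = latticeToPlane l + latticeToPlane m := by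
  simp [latticeToPlane]

theorem annulusSum_latticeToPlane (F : ℝ × (ℝ × ℝ) → ℝ) (R : ℝ) (m : ℤ × ℤ) :
    annulusSum F R (latticeToPlane m) = annulusSum F R 0 := by
  unfold annulusSum
  rw [← (Equiv.addRight m).tsum_eq fun l : ℤ × ℤ =>
    F (euclLength (latticeToPlane l + 0) - R, direction (latticeToPlane l + 0))]
  simp only [Equiv.coe_addRight, latticeToPlane_add, add_zero]

theorem exists_abs_le_of_continuousOn (hF : ContinuousOn F (univ ×ˢ planeCircle))
    (hW : ∀ r u, W < |r| → F (r, u) = 0) :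
    ∃ C, 0 ≤ C ∧ ∀ r, ∀ u ∈ planeCircle, |F (r, u)| ≤ C := by
  obtain ⟨C, hC⟩ := ((isCompact_Icc (a := -W) (b := W)).prod
    isCompact_planeCircle).exists_bound_of_continuousOn
      (hF.mono (prod_mono_left (subset_univ _)))
  refine ⟨max C 0, le_max_right _ _, fun r u hu => ?_⟩
  by_cases hr : W < |r|
  · rw [hW r u hr, abs_zero]; exact le_max_right _ _
  · exact (hC (r, u) ⟨abs_le.mp (not_lt.mp hr), hu⟩).trans (le_max_left _ _)

/-- Uniform continuity on a compact set with a margin of 1 in the radius. Since `δ ≤ 1`, if one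
radius leaves the margin then both lie outside the support and the difference is zero. -/
theorem exists_abs_sub_lt_of_support (hF : ContinuousOn F (univ ×ˢ planeCircle))
    (hW : ∀ r u, W < |r| → F (r, u) = 0) {τ : ℝ} (hτ : 0 < τ) :
    ∃ δ > 0, δ ≤ 1 ∧ ∀ r r', ∀ u ∈ planeCircle, ∀ u' ∈ planeCircle, |r - r'| < δ → dist u u' < δ →
      |F (r, u) - F (r', u')| < τ := by
  have hK := (isCompact_Icc (a := -(W + 1)) (b := W + 1)).prod isCompact_planeCircle
  obtain ⟨δ, hδ, h⟩ := Metric.uniformContinuousOn_iff.mp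
    (hK.uniformContinuousOn_of_continuous (hF.mono (prod_mono_left (subset_univ _)))) τ hτ
  refine ⟨min δ 1, by positivity, min_le_right _ _, fun r r' u hu u' hu' hr hd => ?_⟩
  have hr1 : |r - r'| < 1 := hr.trans_le (min_le_right _ _)
  by_cases h1 : |r| ≤ W + 1
  · by_cases h2 : |r'| ≤ W + 1
    · refine h (r, u) ⟨abs_le.mp h1, hu⟩ (r', u') ⟨abs_le.mp h2, hu'⟩ ?_
      rw [Prod.dist_eq, max_lt_iff]
      exact ⟨hr.trans_le (min_le_left _ _), hd.trans_le (min_le_left _ _)⟩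
    · have := abs_sub_abs_le_abs_sub r' r
      rw [abs_sub_comm] at this
      rw [hW r u (by linarith), hW r' u' (by linarith)]; simpa
  · have := abs_sub_abs_le_abs_sub r r'
    rw [hW r u (by linarith), hW r' u' (by linarith)]; simpa

/-- At distance about `R` a fixed shift `w` turns the direction by `O(1/R)` and changes the length
by its radial component up to `O(1/R)`, uniformly over the annulus. -/
theorem eventually_annulus_shift {g : ℝ × ℝ → ℝ} (hg : Continuous g) (w : ℝ × ℝ) (K : ℝ) {τ : ℝ}
    (hτ : 0 < τ) :
    ∀ᶠ R in atTop, ∀ x, |euclLength x - R| ≤ K →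
      direction x ∈ planeCircle ∧ direction (x + w) ∈ planeCircle ∧
      |g (direction x) - g (direction (x + w))| < τ ∧
      dist (direction x) (direction (x + w)) < τ ∧
      |euclLength (x + w) - euclLength x - dotProd (direction x) w| < τ := by
  obtain ⟨δ, hδ, h⟩ := exists_abs_sub_lt_of_continuousOn isCompact_planeCircle hg.continuousOn hτ
  set L := euclLength w with hL
  have hL0 : 0 ≤ L := euclLength_nonneg w
  set η := min δ τ with hη
  have hη0 : 0 < η := lt_min hδ hτ
  filter_upwards [eventually_gt_atTop (K + L), eventually_gt_atTop (K + 2 * L / η),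
    eventually_gt_atTop (K + L ^ 2 / τ), eventually_gt_atTop K] with R h1 h2 h3 h4 x hx
  have hx0 := pos_euclLength_of_abs_sub_le hx h4
  have hxR := (abs_le.mp hx).1
  have hsub := (abs_le.mp (abs_euclLength_add_sub_le x w)).1
  have hc1 := direction_mem_planeCircle hx0
  have hc2 : direction (x + w) ∈ planeCircle := direction_mem_planeCircle (by linarith)
  have hd : dist (direction x) (direction (x + w)) < η := by
    rw [dist_comm]
    refine (dist_direction_add_le hx0 w).trans_lt ?_
    have : 2 * L / η < euclLength x := by linarith
    rw [div_lt_iff₀ hη0] at this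
    rw [div_lt_iff₀ hx0]; linarith
  refine ⟨hc1, hc2, h _ hc1 _ hc2 (hd.trans_le (min_le_left _ _)),
    hd.trans_le (min_le_right _ _), ?_⟩
  refine (abs_euclLength_add_sub_dotProd_le hx0 w).trans_lt ?_
  have : L ^ 2 / τ < euclLength x := by linarith
  rw [div_lt_iff₀ hτ] at this
  rw [div_lt_iff₀ (by linarith)]
  nlinarith

/-- Comparison of the summands of a weighted annular sum at two points whose difference `w` is
nearly orthogonal to the directions where the weight lives. -/
theorem abs_weighted_sub_le {C ω ε δ τ K : ℝ} (hC : ∀ r, ∀ u ∈ planeCircle, |F (r, u)| ≤ C)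
    (hC0 : 0 ≤ C) (hδ1 : δ ≤ 1) (hεδ : ε + τ ≤ δ) (hε : 0 ≤ ε)
    (hW : ∀ r u, W < |r| → F (r, u) = 0) (hω : 0 ≤ ω)
    (huc : ∀ r r', ∀ u ∈ planeCircle, ∀ u' ∈ planeCircle, |r - r'| < δ → dist u u' < δ →
      |F (r, u) - F (r', u')| < ω)
    {g : ℝ × ℝ → ℝ} (hg0 : ∀ u, 0 ≤ g u) {σ : ℝ} {w x : ℝ × ℝ} {R : ℝ}
    (hgw : ∀ u, g u ≠ 0 → |dotProd u w| < ε) (hK : W + euclLength w ≤ K)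
    (h : |euclLength x - R| ≤ K → direction x ∈ planeCircle ∧ direction (x + w) ∈ planeCircle ∧
      |g (direction x) - g (direction (x + w))| < σ ∧
      dist (direction x) (direction (x + w)) < τ ∧
      |euclLength (x + w) - euclLength x - dotProd (direction x) w| < τ) :
    |g (direction x) * F (euclLength x - R, direction x) -
        g (direction (x + w)) * F (euclLength (x + w) - R, direction (x + w))| ≤
      g (direction x) * (if |euclLength x - R| ≤ W + 1 then ω else 0) +
        (if |euclLength x - R| ≤ K then C * σ else 0) := by
  have hw0 := euclLength_nonneg w
  have habs := abs_euclLength_add_sub_le x w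
  by_cases hx : |euclLength x - R| ≤ K
  · obtain ⟨hc, hc', hgd, hd, hN⟩ := h hx
    rw [if_pos hx]
    have hFC := hC (euclLength (x + w) - R) _ hc'
    -- The first term is small because `w` is nearly orthogonal to `direction x` wherever the weight
    -- there is nonzero; the second because the weight is continuous in the direction.
    have split : ∀ a a' f f' : ℝ, a * f - a' * f' = a * (f - f') + f' * (a - a') := by
      intros; ring
    rw [split]
    refine (abs_add_le _ _).trans (add_le_add ?_ ?_)
    · rw [abs_mul, abs_of_nonneg (hg0 _)]
      by_cases hg : g (direction x) = 0
      · simp [hg]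
      · refine mul_le_mul_of_nonneg_left ?_ (hg0 _)
        have h1 := hgw _ hg
        have h2 : |euclLength x - R - (euclLength (x + w) - R)| < δ := by
          rw [abs_lt] at h1 hN ⊢
          constructor <;> linarith
        split_ifs with hW1
        · exact (huc _ _ _ hc _ hc' h2 (hd.trans_le (by linarith))).le
        · have := abs_sub_abs_le_abs_sub (euclLength x - R) (euclLength (x + w) - R)
          rw [hW _ _ (by linarith), hW _ _ (by linarith)]; simp
    · rw [abs_mul]
      exact mul_le_mul hFC hgd.le (abs_nonneg _) hC0
  -- Beyond `K ≥ W + ‖w‖` both `x` and `x + w` are outside the support of `F`.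
  · have h1 : |euclLength x - R| ≤ |euclLength (x + w) - R| + euclLength w := by
      have := abs_sub_abs_le_abs_sub (euclLength x - R) (euclLength (x + w) - R)
      rw [abs_sub_comm (euclLength x - R)] at this
      simp only [sub_sub_sub_cancel_right] at this
      linarith
    rw [hW _ _ (by linarith), hW _ _ (by linarith)]
    simp only [mul_zero, sub_zero, abs_zero]
    have := hg0 (direction x)
    rw [if_neg hx, add_zero]
    split_ifs <;> positivity

end Shift

/-! ### Asymptotic invariance of annular sums under shifts -/

section ShiftLimit

variable {F : ℝ × (ℝ × ℝ) → ℝ} {W : ℝ}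

theorem tsum_const_annulus_le {K c : ℝ} (hK : 0 ≤ K) (hc : 0 ≤ c) (v : ℝ × ℝ) :
    ∀ᶠ R in atTop, ∑' l : ℤ × ℤ, (if |euclLength (latticeToPlane l + v) - R| ≤ K then c else 0) ≤
      R * (8 * Real.pi * (K + 2) * c) := by
  rcases hc.eq_or_lt with rfl | hc
  · filter_upwards with R
    simp
  -- The constant `c` also serves as the error margin `δ`, which doubles the mean `2πc`; this needs
  -- `c > 0`.
  · filter_upwards [tsum_annulus_le (d := fun _ => c) continuous_const (fun _ => hc.le) hK v
      hc] with R hR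
    refine hR.trans (le_of_eq ?_)
    rw [setIntegral_const, Real.volume_real_Ioo_of_le (by linarith [Real.pi_pos]), smul_eq_mul]
    ring

/-- This makes the defect of the partition of unity harmless: a weight of mean at most `ρ`
contributes `O(ρR)` for any shift, however it is spread over the directions. -/
theorem abs_annulusSum_defect_le {C ρ : ℝ} (hC0 : 0 ≤ C)
    (hC : ∀ r, ∀ u ∈ planeCircle, |F (r, u)| ≤ C) (hW0 : 0 ≤ W)
    (hW : ∀ r u, W < |r| → F (r, u) = 0) {d : ℝ × ℝ → ℝ} (hd : Continuous d)
    (hd0 : ∀ u, 0 ≤ d u) (hρ : 0 < ρ)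
    (hdρ : ∫ θ in Ioo (-Real.pi) Real.pi, d (circlePoint θ) ≤ ρ) (v : ℝ × ℝ) :
    ∀ᶠ R in atTop, |annulusSum (fun p => d p.2 * F p) R v| ≤ R * (4 * C * (W + 2) * ρ) := by
  filter_upwards [tsum_annulus_le hd hd0 hW0 v (δ := ρ / (2 * Real.pi))
    (by have := Real.pi_pos; positivity), eventually_gt_atTop W, eventually_gt_atTop 0]
    with R hR hRW hR0
  have hs : Summable fun l : ℤ × ℤ => (if |euclLength (latticeToPlane l + v) - R| ≤ W then
      d (direction (latticeToPlane l + v)) else 0) :=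
    summable_of_annulus v R W fun l hl => if_neg (not_le.mpr hl)
  have h1 : ∀ l : ℤ × ℤ, ‖d (direction (latticeToPlane l + v)) *
      F (euclLength (latticeToPlane l + v) - R, direction (latticeToPlane l + v))‖ ≤
      C * (if |euclLength (latticeToPlane l + v) - R| ≤ W then
        d (direction (latticeToPlane l + v)) else 0) := by
    intro l
    rw [Real.norm_eq_abs, abs_mul, abs_of_nonneg (hd0 _)]
    split_ifs with h
    · rw [mul_comm]
      exact mul_le_mul_of_nonneg_right
        (hC _ _ (direction_mem_planeCircle (pos_euclLength_of_abs_sub_le h hRW))) (hd0 _)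
    · rw [hW _ _ (not_le.mp h)]; simp
  have h2 := tsum_of_norm_bounded (hs.mul_left C).hasSum h1
  rw [tsum_mul_left] at h2
  refine h2.trans ((mul_le_mul_of_nonneg_left hR hC0).trans ?_)
  rw [mul_div_cancel₀ _ (by have := Real.pi_pos; positivity)]
  calc C * (R * (2 * (W + 2) * (_ + ρ))) ≤ C * (R * (2 * (W + 2) * (ρ + ρ))) := by gcongr
    _ = _ := by ring

theorem annulusSum_eq_sum_weights (hW : ∀ r u, W < |r| → F (r, u) = 0) (R ε : ℝ) (v : ℝ × ℝ)
    (M : ℕ) (x : ℝ × ℝ) :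
    annulusSum F R x = ∑ m ∈ latticeBox M, annulusSum (fun p => normWeight ε v M m p.2 * F p) R x +
      annulusSum (fun p => weightDefect ε v M p.2 * F p) R x := by
  have hg : ∀ g : ℝ × ℝ → ℝ, Summable fun l : ℤ × ℤ => g (direction (latticeToPlane l + x)) *
      F (euclLength (latticeToPlane l + x) - R, direction (latticeToPlane l + x)) :=
    fun g => summable_annulusSum (W := W) (F := fun p => g p.2 * F p)
      (fun r u hr => by simp [hW r u hr]) R x
  unfold annulusSum
  rw [← Summable.tsum_finsetSum fun m _ => hg _, ← (summable_sum fun m _ => hg _).tsum_add (hg _)]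
  refine tsum_congr fun l => ?_
  rw [← Finset.sum_mul, ← add_mul, sum_normWeight_add_weightDefect, one_mul]

/-- Shifting the lattice does not change annular sums up to `o(R)`. -/
theorem tendsto_annulusSum_sub (hF : ContinuousOn F (univ ×ˢ planeCircle)) (hW0 : 0 ≤ W)
    (hW : ∀ r u, W < |r| → F (r, u) = 0) (v : ℝ × ℝ) :
    Tendsto (fun R => R⁻¹ * (annulusSum F R v - annulusSum F R 0)) atTop (𝓝 0) := by
  rw [Metric.tendsto_nhds]
  intro κ hκ
  have hpi := Real.pi_pos
  obtain ⟨C, hC0, hC⟩ := exists_abs_le_of_continuousOn hF hW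
  -- Four errors are each given the share `κ / 8`: the variation of `F` (through `ω`), the variation
  -- of the weights (through `σ`), and the defects at `v` and at `0` (through `ρ`). The order of
  -- choice matters: `M` depends on `ρ` and `δ`, while `σ` depends on `M`.
  set ω := κ / (8 * (8 * Real.pi * (W + 1 + 2))) with hω
  have hω0 : 0 < ω := by positivity
  obtain ⟨δ, hδ0, hδ1, huc⟩ := exists_abs_sub_lt_of_support hF hW hω0
  set ρ := κ / (8 * (4 * (C + 1) * (W + 2))) with hρ
  have hρ0 : 0 < ρ := by positivity
  obtain ⟨M, hM⟩ := ((tendsto_integral_weightDefect v (half_pos hδ0)).eventually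
    (eventually_le_nhds hρ0)).exists
  obtain ⟨D, hD0, hD⟩ : ∃ D, 0 ≤ D ∧ ∀ m ∈ latticeBox M, euclLength (latticeToPlane m - v) ≤ D :=
    ⟨∑ m ∈ latticeBox M, euclLength (latticeToPlane m - v),
      Finset.sum_nonneg fun m _ => euclLength_nonneg _, fun m hm =>
      Finset.single_le_sum (fun m _ => euclLength_nonneg (latticeToPlane m - v)) hm⟩
  set K := W + D with hK
  have hK0 : 0 ≤ K := by positivity
  set n := ((latticeBox M).card : ℝ) with hn
  have hn0 : 0 ≤ n := by positivity
  set σ := κ / (8 * (8 * Real.pi * (K + 2) * (C + 1) * (n + 1))) with hσ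
  have hσ0 : 0 < σ := by positivity
  set τ := min σ (δ / 2) with hτ
  have hτ0 : 0 < τ := by positivity
  have hshift : ∀ᶠ R in atTop, ∀ m ∈ latticeBox M, ∀ x, |euclLength x - R| ≤ K →
      direction x ∈ planeCircle ∧ direction (x + (latticeToPlane m - v)) ∈ planeCircle ∧
      |normWeight (δ / 2) v M m (direction x) -
        normWeight (δ / 2) v M m (direction (x + (latticeToPlane m - v)))| < τ ∧
      dist (direction x) (direction (x + (latticeToPlane m - v))) < τ ∧
      |euclLength (x + (latticeToPlane m - v)) - euclLength x -
        dotProd (direction x) (latticeToPlane m - v)| < τ :=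
    (Finset.eventually_all _).mpr fun m _ =>
      eventually_annulus_shift (continuous_normWeight (δ / 2) v M m) _ K hτ0
  filter_upwards [hshift, eventually_gt_atTop 0,
    tsum_const_annulus_le (K := W + 1) (by positivity) hω0.le v,
    tsum_const_annulus_le (K := K) (c := n * (C * σ)) hK0 (by positivity) v,
    abs_annulusSum_defect_le hC0 hC hW0 hW (continuous_weightDefect (δ / 2) v M)
      (weightDefect_nonneg _ _ _) hρ0 hM v,
    abs_annulusSum_defect_le hC0 hC hW0 hW (continuous_weightDefect (δ / 2) v M)
      (weightDefect_nonneg _ _ _) hρ0 hM 0] with R hR hR0 hb1 hb2 hd1 hd2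
  have hsub : |∑ m ∈ latticeBox M, annulusSum (fun p => normWeight (δ / 2) v M m p.2 * F p) R v -
      ∑ m ∈ latticeBox M, annulusSum (fun p => normWeight (δ / 2) v M m p.2 * F p) R 0| ≤
      R * (8 * Real.pi * (W + 1 + 2) * ω) + R * (8 * Real.pi * (K + 2) * (n * (C * σ))) := by
    have hg : ∀ m x, Summable fun l : ℤ × ℤ =>
        normWeight (δ / 2) v M m (direction (latticeToPlane l + x)) *
        F (euclLength (latticeToPlane l + x) - R, direction (latticeToPlane l + x)) :=
      fun m x => summable_annulusSum (W := W) (F := fun p => normWeight (δ / 2) v M m p.2 * F p)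
        (fun r u hr => by simp [hW r u hr]) R x
    have hs1 : Summable fun l : ℤ × ℤ =>
        (if |euclLength (latticeToPlane l + v) - R| ≤ W + 1 then ω else 0) :=
      summable_of_annulus v R (W + 1) fun l hl => if_neg (not_le.mpr hl)
    have hs2 : Summable fun l : ℤ × ℤ =>
        (if |euclLength (latticeToPlane l + v) - R| ≤ K then n * (C * σ) else 0) :=
      summable_of_annulus v R K fun l hl => if_neg (not_le.mpr hl)
    rw [← Finset.sum_sub_distrib]
    -- By lattice invariance the sum with weight `m` at shift `0` is the sum at shift `m`, so each
    -- weight is compared across its own displacement `m - v`.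
    have e : ∑ m ∈ latticeBox M, (annulusSum (fun p => normWeight (δ / 2) v M m p.2 * F p) R v -
        annulusSum (fun p => normWeight (δ / 2) v M m p.2 * F p) R 0) =
        ∑' l : ℤ × ℤ, ∑ m ∈ latticeBox M,
        (normWeight (δ / 2) v M m (direction (latticeToPlane l + v)) *
          F (euclLength (latticeToPlane l + v) - R, direction (latticeToPlane l + v)) -
        normWeight (δ / 2) v M m (direction (latticeToPlane l + latticeToPlane m)) *
          F (euclLength (latticeToPlane l + latticeToPlane m) - R,
            direction (latticeToPlane l + latticeToPlane m))) := by
      rw [Summable.tsum_finsetSum fun m _ => (hg m v).sub (hg m _)]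
      exact Finset.sum_congr rfl fun m _ => by
        rw [← annulusSum_latticeToPlane _ R m]
        exact ((hg m v).tsum_sub (hg m _)).symm
    rw [e, ← Real.norm_eq_abs]
    refine le_trans (b := ∑' l : ℤ × ℤ,
      ((if |euclLength (latticeToPlane l + v) - R| ≤ W + 1 then ω else 0) +
        (if |euclLength (latticeToPlane l + v) - R| ≤ K then n * (C * σ) else 0))) ?_ ?_
    · refine tsum_of_norm_bounded (hs1.add hs2).hasSum fun l => ?_
      rw [Real.norm_eq_abs]
      refine (Finset.abs_sum_le_sum_abs _ _).trans ?_
      have hterm : ∀ m ∈ latticeBox M, _ ≤ _ := fun m hm =>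
        abs_weighted_sub_le (F := F) (W := W) (x := latticeToPlane l + v) (R := R) (σ := σ)
        (w := latticeToPlane m - v) (ε := δ / 2) (τ := δ / 2) (K := K)
        (g := normWeight (δ / 2) v M m) hC hC0 hδ1 (by linarith) (by linarith) hW
        hω0.le huc (normWeight_nonneg _ _ _ _)
        (fun u hu => abs_dotProd_lt_of_normWeight_ne_zero _ _ _ _ hu)
        (by have := hD m hm; linarith)
        (fun hx => by
          obtain ⟨h1, h2, h3, h4, h5⟩ := hR m hm _ hx
          exact ⟨h1, h2, h3.trans_le (min_le_left _ _), h4.trans_le (min_le_right _ _),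
            h5.trans_le (min_le_right _ _)⟩)
      simp only [show ∀ m, latticeToPlane l + v + (latticeToPlane m - v) =
        latticeToPlane l + latticeToPlane m from fun m => by abel] at hterm
      refine (Finset.sum_le_sum hterm).trans ?_
      rw [Finset.sum_add_distrib, ← Finset.sum_mul, Finset.sum_const, nsmul_eq_mul]
      refine add_le_add ?_ ?_
      · refine (mul_le_mul_of_nonneg_right (sum_normWeight_le_one _ _ _ _) ?_).trans
          (one_mul _).le
        split_ifs <;> positivity
      · rw [mul_ite, mul_zero]
    · rw [hs1.tsum_add hs2]
      exact add_le_add hb1 hb2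
  rw [annulusSum_eq_sum_weights hW R (δ / 2) v M v, annulusSum_eq_sum_weights hW R (δ / 2) v M 0,
    Real.dist_eq, sub_zero, abs_mul, abs_inv, abs_of_pos hR0, inv_mul_lt_iff₀ hR0]
  have b1 : 8 * Real.pi * (W + 1 + 2) * ω = κ / 8 := by rw [hω]; field_simp
  have b2 : 8 * Real.pi * (K + 2) * (n * (C * σ)) ≤ κ / 8 := by
    calc _ ≤ 8 * Real.pi * (K + 2) * ((n + 1) * ((C + 1) * σ)) := by gcongr <;> linarith
      _ = κ / 8 := by rw [hσ]; field_simp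
  have b3 : 4 * C * (W + 2) * ρ ≤ κ / 8 := by
    calc _ ≤ 4 * (C + 1) * (W + 2) * ρ := by gcongr; linarith
      _ = κ / 8 := by rw [hρ]; field_simp
  rw [b1] at hsub
  have b2' := mul_le_mul_of_nonneg_left b2 hR0.le
  have b3' := mul_le_mul_of_nonneg_left b3 hR0.le
  have hκR : 0 < R * κ := by positivity
  rw [abs_le] at hd1 hd2 hsub
  rw [abs_lt]
  constructor <;> linarith

end ShiftLimit

/-! ### Equidistribution for continuous test functions -/

section Equidistribution

variable {F : ℝ × (ℝ × ℝ) → ℝ} {W : ℝ}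

theorem measurable_radial (hF : ContinuousOn F (univ ×ˢ planeCircle)) (R : ℝ) :
    Measurable fun x => F (euclLength x - R, direction x) := by
  refine measurable_of_continuousOn_compl_singleton 0 ?_
  refine hF.comp ((continuous_euclLength.continuousOn.sub continuousOn_const).prodMk
    continuousOn_direction) fun x hx => ⟨mem_univ _, direction_mem_planeCircle ?_⟩
  exact (euclLength_nonneg x).lt_of_ne' fun h => hx (euclLength_eq_zero.mp h)

theorem continuous_radial (hF : ContinuousOn F (univ ×ˢ planeCircle)) :
    Continuous fun p : ℝ × ℝ => F (p.1, circlePoint p.2) :=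
  hF.comp_continuous (continuous_fst.prodMk (continuous_circlePoint.comp continuous_snd))
    fun _ => ⟨mem_univ _, circlePoint_mem_planeCircle _⟩

theorem abs_radial_le {C : ℝ} (hC0 : 0 ≤ C) (hC : ∀ r, ∀ u ∈ planeCircle, |F (r, u)| ≤ C)
    (hW : ∀ r u, W < |r| → F (r, u) = 0) {R : ℝ} (hR : W < R) (x : ℝ × ℝ) :
    |F (euclLength x - R, direction x)| ≤ C := by
  by_cases h : |euclLength x - R| ≤ W
  · exact hC _ _ (direction_mem_planeCircle (pos_euclLength_of_abs_sub_le h hR))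
  · rw [hW _ _ (not_le.mp h), abs_zero]; exact hC0

/-- The index set is the same for all `v` in the cell, so the sum can be treated as finite when
integrating over `v`. The margin 2 bounds the length of `v`. -/
theorem annulusSum_eq_sum (hW : ∀ r u, W < |r| → F (r, u) = 0) (R : ℝ) {v : ℝ × ℝ}
    (hv : v ∈ unitCell) :
    annulusSum F R v = ∑ l ∈ (finite_setOf_abs_euclLength_sub_le 0 R (W + 2)).toFinset,
      F (euclLength (latticeToPlane l + v) - R, direction (latticeToPlane l + v)) := by
  refine tsum_eq_sum fun l hl => hW _ _ ?_
  simp only [add_zero, Set.Finite.mem_toFinset, mem_ofPred_eq, not_le] at hl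
  have h1 := abs_euclLength_add_sub_le (latticeToPlane l) v
  have h2 := euclLength_le_two hv
  have h3 := abs_sub_abs_le_abs_sub (euclLength (latticeToPlane l) - R)
    (euclLength (latticeToPlane l + v) - R)
  rw [abs_sub_comm (euclLength (latticeToPlane l) - R)] at h3
  simp only [sub_sub_sub_cancel_right] at h3
  linarith

theorem integrable_radial (hF : ContinuousOn F (univ ×ˢ planeCircle))
    (hW : ∀ r u, W < |r| → F (r, u) = 0) {R : ℝ} (hR : W < R) :
    Integrable fun x => F (euclLength x - R, direction x) := by
  obtain ⟨C, hC0, hC⟩ := exists_abs_le_of_continuousOn hF hW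
  exact integrable_of_annulus (measurable_radial hF R) (R := R) (K := W)
    (fun x hx => hW _ _ hx) (abs_radial_le hC0 hC hW hR)

theorem integral_unitCell_annulusSum (hF : ContinuousOn F (univ ×ˢ planeCircle))
    (hW : ∀ r u, W < |r| → F (r, u) = 0) {R : ℝ} (hR : W < R) :
    ∫ v in unitCell, annulusSum F R v = ∫ x, F (euclLength x - R, direction x) := by
  have hint := integrable_radial hF hW hR
  rw [setIntegral_congr_fun measurableSet_unitCell fun v hv => annulusSum_eq_sum hW R hv,
    integral_finsetSum _ fun l _ => (hint.comp_add_left (latticeToPlane l)).integrableOn,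
    ← (hasSum_integral_unitCell hint).tsum_eq]
  symm
  refine tsum_eq_sum fun l hl => ?_
  refine setIntegral_eq_zero_of_forall_eq_zero fun v hv => hW _ _ ?_
  simp only [add_zero, Set.Finite.mem_toFinset, mem_ofPred_eq, not_le] at hl
  have h1 := abs_euclLength_add_sub_le (latticeToPlane l) v
  have h2 := euclLength_le_two hv
  have h3 := abs_sub_abs_le_abs_sub (euclLength (latticeToPlane l) - R)
    (euclLength (latticeToPlane l + v) - R)
  rw [abs_sub_comm (euclLength (latticeToPlane l) - R)] at h3
  simp only [sub_sub_sub_cancel_right] at h3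
  linarith

/-- Supplies the dominating function when the shift is averaged over the cell. -/
theorem eventually_abs_annulusSum_le {C : ℝ} (hC0 : 0 ≤ C)
    (hC : ∀ r, ∀ u ∈ planeCircle, |F (r, u)| ≤ C) (hW0 : 0 ≤ W)
    (hW : ∀ r u, W < |r| → F (r, u) = 0) :
    ∀ᶠ R in atTop, ∀ v ∈ unitCell, |annulusSum F R v| ≤ R * (8 * Real.pi * (W + 4) * C) := by
  filter_upwards [tsum_const_annulus_le (K := W + 2) (by positivity) hC0 0,
    eventually_gt_atTop W] with R hR hRW v hv
  rw [annulusSum_eq_sum hW R hv]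
  rw [tsum_eq_sum (s := (finite_setOf_abs_euclLength_sub_le 0 R (W + 2)).toFinset)
    fun l hl => if_neg (by simpa using hl)] at hR
  refine (Finset.abs_sum_le_sum_abs _ _).trans ((Finset.sum_le_sum fun l hl => ?_).trans
    (hR.trans (le_of_eq (by ring))))
  rw [if_pos (by simpa using hl)]
  exact abs_radial_le hC0 hC hW hRW _

/-- The plane integral is the average of the annular sums over all shifts in the cell; each differs
from the unshifted sum by `o(R)`, and dominated convergence passes this to the average. -/
theorem tendsto_annulusSum_sub_integral (hF : ContinuousOn F (univ ×ˢ planeCircle)) (hW0 : 0 ≤ W)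
    (hW : ∀ r u, W < |r| → F (r, u) = 0) :
    Tendsto (fun R => R⁻¹ * ((∫ x, F (euclLength x - R, direction x)) - annulusSum F R 0)) atTop
      (𝓝 0) := by
  obtain ⟨C, hC0, hC⟩ := exists_abs_le_of_continuousOn hF hW
  have hzero : (0 : ℝ × ℝ) ∈ unitCell := by simp [unitCell]
  have : IsFiniteMeasure ((volume : Measure (ℝ × ℝ)).restrict unitCell) :=
    ⟨by simp [volume_unitCell]⟩
  have hmeas : ∀ R, AEStronglyMeasurable (annulusSum F R) (volume.restrict unitCell) := by
    intro R
    have : Measurable fun v : ℝ × ℝ =>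
        ∑ l ∈ (finite_setOf_abs_euclLength_sub_le 0 R (W + 2)).toFinset,
        F (euclLength (latticeToPlane l + v) - R, direction (latticeToPlane l + v)) :=
      Finset.measurable_fun_sum _ fun l _ =>
        (measurable_radial hF R).comp (measurable_const_add _)
    refine this.aestronglyMeasurable.congr ?_
    filter_upwards [ae_restrict_mem measurableSet_unitCell] with v hv
    exact (annulusSum_eq_sum hW R hv).symm
  have hlim : Tendsto (fun R => ∫ v in unitCell, R⁻¹ * (annulusSum F R v - annulusSum F R 0)) atTop
      (𝓝 (∫ v in unitCell, (0 : ℝ))) := by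
    refine tendsto_integral_filter_of_dominated_convergence
      (fun _ => 2 * (8 * Real.pi * (W + 4) * C)) ?_ ?_ ?_ ?_
    · exact Eventually.of_forall fun R =>
        ((hmeas R).sub aestronglyMeasurable_const).const_mul _
    · filter_upwards [eventually_abs_annulusSum_le hC0 hC hW0 hW, eventually_gt_atTop 0]
        with R hR hR0
      filter_upwards [ae_restrict_mem measurableSet_unitCell] with v hv
      have h1 := hR v hv
      have h2 := hR 0 hzero
      rw [Real.norm_eq_abs, abs_mul, abs_inv, abs_of_pos hR0, inv_mul_le_iff₀ hR0]
      exact (abs_sub _ _).trans (by linarith)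
    · exact integrable_const _
    · exact ae_of_all _ fun v => tendsto_annulusSum_sub hF hW0 hW v
  rw [integral_zero] at hlim
  refine hlim.congr' ?_
  filter_upwards [eventually_gt_atTop W, eventually_abs_annulusSum_le hC0 hC hW0 hW]
    with R hR hRb
  have hi : IntegrableOn (annulusSum F R) unitCell :=
    Integrable.of_bound (hmeas R) _
      (by filter_upwards [ae_restrict_mem measurableSet_unitCell] with v hv using hRb v hv)
  rw [integral_const_mul, integral_sub hi (integrable_const _),
    integral_unitCell_annulusSum hF hW hR, setIntegral_const, volume_real_unitCell, one_smul]

theorem integrableOn_strip {g : ℝ × ℝ → ℝ} (hg : Continuous g)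
    (h0 : ∀ p : ℝ × ℝ, W < |p.1| → g p = 0) :
    IntegrableOn g (univ ×ˢ Ioo (-Real.pi) Real.pi) := by
  have h := hg.continuousOn.integrableOn_compact (μ := volume)
    ((isCompact_Icc (a := -W) (b := W)).prod (isCompact_Icc (a := -Real.pi) (b := Real.pi)))
  refine h.of_forall_sdiff_eq_zero (MeasurableSet.univ.prod measurableSet_Ioo) ?_
  rintro p ⟨⟨-, hp⟩, hp'⟩
  refine h0 p (not_le.mp fun h => hp' ⟨abs_le.mp h, Ioo_subset_Icc_self hp⟩)

/-- Equidistribution of the lattice points near the circle of radius `R` with respect to the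
distance to the circle and the direction. -/
theorem tendsto_annulusSum (hF : ContinuousOn F (univ ×ˢ planeCircle)) (hW0 : 0 ≤ W)
    (hW : ∀ r u, W < |r| → F (r, u) = 0) :
    Tendsto (fun R => R⁻¹ * annulusSum F R 0) atTop
      (𝓝 (∫ p in univ ×ˢ Ioo (-Real.pi) Real.pi, F (p.1, circlePoint p.2))) := by
  set I := ∫ p in univ ×ˢ Ioo (-Real.pi) Real.pi, F (p.1, circlePoint p.2)
  set J := ∫ p in univ ×ˢ Ioo (-Real.pi) Real.pi, p.1 * F (p.1, circlePoint p.2)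
  have hc := continuous_radial hF
  have h1 := integrableOn_strip (W := W) hc fun p hp => hW _ _ hp
  have h2 : IntegrableOn (fun p : ℝ × ℝ => p.1 * F (p.1, circlePoint p.2))
      (univ ×ˢ Ioo (-Real.pi) Real.pi) :=
    integrableOn_strip (W := W) (continuous_fst.mul hc) fun p hp => by simp [hW _ _ hp]
  -- In polar coordinates the plane integral is `R * I + J`; the term `J` from the Jacobian
  -- disappears after division by `R`.
  have hlim : Tendsto (fun R : ℝ => I + R⁻¹ * J -
      R⁻¹ * ((∫ x, F (euclLength x - R, direction x)) - annulusSum F R 0)) atTop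
      (𝓝 (I + 0 * J - 0)) :=
    (tendsto_const_nhds.add (tendsto_inv_atTop_zero.mul_const J)).sub
      (tendsto_annulusSum_sub_integral hF hW0 hW)
  rw [zero_mul, add_zero, sub_zero] at hlim
  refine hlim.congr' ?_
  filter_upwards [eventually_gt_atTop W, eventually_gt_atTop 0] with R hR hR0
  rw [integral_annulus_eq hW hR0 hR]
  simp_rw [add_mul]
  rw [integral_add (h1.const_mul R) h2, integral_const_mul]
  field_simp
  ring

end Equidistribution

/-! ### From continuous test functions to the sharp annulus -/

section Cutoff

/-- A continuous function of `|r|` equal to one below `a - δ` and to zero above `a`. -/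
noncomputable def cutoff (a δ r : ℝ) : ℝ := max 0 (min 1 ((a - |r|) / δ))

/-- A continuous bump around `|r| = a` of width `2 * δ`. -/
noncomputable def edgeBump (a δ r : ℝ) : ℝ := max 0 (min 1 (2 - |(|r| - a)| / δ))

theorem continuous_cutoff (a δ : ℝ) : Continuous (cutoff a δ) := by
  unfold cutoff; fun_prop

theorem continuous_edgeBump (a δ : ℝ) : Continuous (edgeBump a δ) := by
  unfold edgeBump; fun_prop

theorem cutoff_eq_zero {a δ r : ℝ} (hδ : 0 < δ) (h : a ≤ |r|) : cutoff a δ r = 0 :=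
  max_eq_left ((min_le_right _ _).trans (div_nonpos_of_nonpos_of_nonneg (by linarith) hδ.le))

theorem edgeBump_eq_zero {a δ r : ℝ} (hδ : 0 < δ) (h : 2 * δ ≤ |(|r| - a)|) :
    edgeBump a δ r = 0 :=
  max_eq_left ((min_le_right _ _).trans (by rw [sub_nonpos, le_div_iff₀ hδ]; exact h))

theorem edgeBump_nonneg (a δ r : ℝ) : 0 ≤ edgeBump a δ r := le_max_left _ _

theorem edgeBump_le_one (a δ r : ℝ) : edgeBump a δ r ≤ 1 :=
  max_le zero_le_one (min_le_left _ _)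

theorem cutoff_mem_Icc (a δ r : ℝ) : cutoff a δ r ∈ Icc (0 : ℝ) 1 :=
  ⟨le_max_left _ _, max_le zero_le_one (min_le_left _ _)⟩

theorem abs_ite_sub_cutoff_le {a δ : ℝ} (hδ : 0 < δ) (r : ℝ) :
    |(if |r| < a then 1 else 0) - cutoff a δ r| ≤ edgeBump a δ r := by
  split_ifs with h
  · by_cases h1 : |r| ≤ a - δ
    · have : cutoff a δ r = 1 := by
        rw [cutoff, min_eq_left (by rw [le_div_iff₀ hδ]; linarith), max_eq_right zero_le_one]
      rw [this, sub_self, abs_zero]; exact edgeBump_nonneg _ _ _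
    · have : edgeBump a δ r = 1 := by
        rw [edgeBump, min_eq_left, max_eq_right zero_le_one]
        have : |(|r| - a)| / δ ≤ 1 := by
          rw [div_le_one hδ, abs_le]; constructor <;> linarith
        linarith
      obtain ⟨h2, h3⟩ := cutoff_mem_Icc a δ r
      rw [this, abs_le]; constructor <;> linarith
  · rw [cutoff_eq_zero hδ (not_lt.mp h), sub_self, abs_zero]; exact edgeBump_nonneg _ _ _

/-- The bump is at most 1 and lives on two intervals of length `4δ`; the angle contributes `2π`. -/
theorem integral_edgeBump_le {a δ : ℝ} (hδ : 0 < δ) :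
    ∫ p in univ ×ˢ Ioo (-Real.pi) Real.pi, edgeBump a δ p.1 ≤ 16 * Real.pi * δ := by
  have hpi := Real.pi_pos
  have hle : ∀ r, edgeBump a δ r ≤ (Icc (a - 2 * δ) (a + 2 * δ)).indicator (fun _ => (1 : ℝ)) r +
      (Icc (-a - 2 * δ) (-a + 2 * δ)).indicator (fun _ => (1 : ℝ)) r := by
    intro r
    have n1 : 0 ≤ (Icc (a - 2 * δ) (a + 2 * δ)).indicator (fun _ => (1 : ℝ)) r :=
      indicator_nonneg (fun _ _ => zero_le_one) _
    have n2 : 0 ≤ (Icc (-a - 2 * δ) (-a + 2 * δ)).indicator (fun _ => (1 : ℝ)) r :=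
      indicator_nonneg (fun _ _ => zero_le_one) _
    by_cases h : 2 * δ ≤ |(|r| - a)|
    · rw [edgeBump_eq_zero hδ h]; positivity
    · have h1 := abs_lt.mp (not_le.mp h)
      have h2 := edgeBump_le_one a δ r
      rcases abs_cases r with ⟨h3, -⟩ | ⟨h3, -⟩
      · rw [h3] at h1
        rw [indicator_of_mem (by constructor <;> linarith)]; linarith
      · rw [h3] at h1
        rw [indicator_of_mem (a := r) (s := Icc (-a - 2 * δ) (-a + 2 * δ))
          (by constructor <;> linarith)]; linarith
  have hi : ∀ b, Integrable
      ((Icc (b - 2 * δ) (b + 2 * δ)).indicator (fun _ => (1 : ℝ))) := fun b =>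
    (integrable_indicator_iff measurableSet_Icc).mpr (by simp)
  have hbump : Integrable (edgeBump a δ) := by
    refine ((hi a).add (hi (-a))).mono' (continuous_edgeBump a δ).aestronglyMeasurable ?_
    refine ae_of_all _ fun r => ?_
    rw [Real.norm_eq_abs, abs_of_nonneg (edgeBump_nonneg _ _ _)]
    exact hle r
  have hb : ∫ r, edgeBump a δ r ≤ 8 * δ := by
    refine (integral_mono hbump ((hi a).add (hi (-a))) hle).trans ?_
    rw [integral_add' (hi a) (hi (-a)), integral_indicator measurableSet_Icc,
      integral_indicator measurableSet_Icc, setIntegral_const, setIntegral_const,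
      Real.volume_real_Icc_of_le (by linarith), Real.volume_real_Icc_of_le (by linarith)]
    simp only [smul_eq_mul]
    linarith
  have := setIntegral_prod_mul (μ := volume) (ν := volume) (edgeBump a δ) (fun _ : ℝ => (1 : ℝ))
    univ (Ioo (-Real.pi) Real.pi)
  simp only [mul_one, ← Measure.volume_eq_prod] at this
  rw [this, setIntegral_univ, setIntegral_const, Real.volume_real_Ioo_of_le (by linarith),
    smul_eq_mul]
  nlinarith

variable {F : ℝ × (ℝ × ℝ) → ℝ} {a C : ℝ}

/-- Equidistribution of the lattice points of an open annulus of fixed width. -/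
theorem tendsto_tsum_annulus (hF : ContinuousOn F (univ ×ˢ planeCircle)) (ha : 0 < a) (hC0 : 0 ≤ C)
    (hC : ∀ r, ∀ u ∈ planeCircle, |F (r, u)| ≤ C) :
    Tendsto (fun R => R⁻¹ * ∑' l : ℤ × ℤ, (if |euclLength (latticeToPlane l) - R| < a then
        F (euclLength (latticeToPlane l) - R, direction (latticeToPlane l)) else 0)) atTop
      (𝓝 (∫ p in Ioo (-a) a ×ˢ Ioo (-Real.pi) Real.pi, F (p.1, circlePoint p.2))) := by
  have hpi := Real.pi_pos
  rw [Metric.tendsto_nhds]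
  intro κ hκ
  set δ := κ / (8 * (16 * Real.pi * (C + 1))) with hδ
  have hδ0 : 0 < δ := by positivity
  set A : ℝ × (ℝ × ℝ) → ℝ := fun p => cutoff a δ p.1 * F p with hA
  set B : ℝ × (ℝ × ℝ) → ℝ := fun p => edgeBump a δ p.1 with hB
  have hAc : ContinuousOn A (univ ×ˢ planeCircle) :=
    ((continuous_cutoff a δ).comp continuous_fst).continuousOn.mul hF
  have hBc : ContinuousOn B (univ ×ˢ planeCircle) :=
    ((continuous_edgeBump a δ).comp continuous_fst).continuousOn
  have hA0 : ∀ r u, a < |r| → A (r, u) = 0 := fun r u hr => by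
    simp [hA, cutoff_eq_zero hδ0 hr.le]
  have hB0 : ∀ r u, a + 2 * δ < |r| → B (r, u) = 0 := fun r u hr => by
    simp only [hB]
    exact edgeBump_eq_zero hδ0 (by have := le_abs_self (|r| - a); linarith)
  -- This single pointwise bound controls both the error in the sum and the error in the integral;
  -- the sum of bumps is itself evaluated by equidistribution.
  have hpt : ∀ r, ∀ u ∈ planeCircle, |(if |r| < a then F (r, u) else 0) - A (r, u)| ≤
      C * B (r, u) := by
    intro r u hu
    have : (if |r| < a then F (r, u) else 0) - A (r, u) =
        F (r, u) * ((if |r| < a then 1 else 0) - cutoff a δ r) := by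
      simp only [hA]; split_ifs <;> ring
    rw [this, abs_mul]
    exact mul_le_mul (hC r u hu) (abs_ite_sub_cutoff_le hδ0 r) (abs_nonneg _) hC0
  have hlA := Metric.tendsto_nhds.mp (tendsto_annulusSum hAc ha.le hA0) (κ / 8) (by positivity)
  have hlB := Metric.tendsto_nhds.mp (tendsto_annulusSum hBc (by positivity) hB0)
    (κ / (8 * (C + 1))) (by positivity)
  have hI : |(∫ p in Ioo (-a) a ×ˢ Ioo (-Real.pi) Real.pi, F (p.1, circlePoint p.2)) -
      ∫ p in univ ×ˢ Ioo (-Real.pi) Real.pi, A (p.1, circlePoint p.2)| ≤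
      C * ∫ p in univ ×ˢ Ioo (-Real.pi) Real.pi, B (p.1, circlePoint p.2) := by
    have hFi : IntegrableOn (fun p : ℝ × ℝ => F (p.1, circlePoint p.2))
        (Ioo (-a) a ×ˢ Ioo (-Real.pi) Real.pi) :=
      ((continuous_radial hF).continuousOn.integrableOn_compact ((isCompact_Icc (a := -a) (b := a)).prod
        (isCompact_Icc (a := -Real.pi) (b := Real.pi)))).mono_set
          (prod_mono Ioo_subset_Icc_self Ioo_subset_Icc_self)
    have e : (fun p : ℝ × ℝ => if |p.1| < a then F (p.1, circlePoint p.2) else 0) =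
        (Ioo (-a) a ×ˢ univ).indicator fun p => F (p.1, circlePoint p.2) := by
      ext p
      simp [indicator, abs_lt]
    have hm : MeasurableSet (Ioo (-a) a ×ˢ (univ : Set ℝ)) :=
      measurableSet_Ioo.prod MeasurableSet.univ
    have hset : (Ioo (-a) a ×ˢ univ) ∩ (univ ×ˢ Ioo (-Real.pi) Real.pi) =
        Ioo (-a) a ×ˢ Ioo (-Real.pi) Real.pi := by
      rw [prod_inter_prod, inter_univ, univ_inter]
    have h1 : ∫ p in Ioo (-a) a ×ˢ Ioo (-Real.pi) Real.pi, F (p.1, circlePoint p.2) =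
        ∫ p in univ ×ˢ Ioo (-Real.pi) Real.pi,
          (if |p.1| < a then F (p.1, circlePoint p.2) else 0) := by
      rw [e, integral_indicator hm, Measure.restrict_restrict hm, hset]
    have h2 : IntegrableOn (fun p : ℝ × ℝ => if |p.1| < a then F (p.1, circlePoint p.2) else 0)
        (univ ×ˢ Ioo (-Real.pi) Real.pi) := by
      rw [e, IntegrableOn, integrable_indicator_iff hm, IntegrableOn,
        Measure.restrict_restrict hm, hset]
      exact hFi
    have h3 := integrableOn_strip (W := a) (continuous_radial hAc) fun p hp => hA0 _ _ hp
    have h4 := integrableOn_strip (W := a + 2 * δ) (continuous_radial hBc) fun p hp => hB0 _ _ hp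
    rw [h1, ← integral_sub h2 h3, ← integral_const_mul, ← Real.norm_eq_abs]
    exact norm_integral_le_of_norm_le (h4.const_mul C)
      (ae_of_all _ fun p => hpt _ _ (circlePoint_mem_planeCircle _))
  have hIB : ∫ p in univ ×ˢ Ioo (-Real.pi) Real.pi, B (p.1, circlePoint p.2) ≤
      16 * Real.pi * δ := integral_edgeBump_le hδ0
  filter_upwards [hlA, hlB, eventually_gt_atTop 0, eventually_gt_atTop (a + 2 * δ)]
    with R hRA hRB hR0 hRa
  set SA := annulusSum A R 0 with hSA
  set SB := annulusSum B R 0 with hSB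
  set SF := ∑' l : ℤ × ℤ, (if |euclLength (latticeToPlane l) - R| < a then
        F (euclLength (latticeToPlane l) - R, direction (latticeToPlane l)) else 0) with hSF
  have hsum : |SF - SA| ≤ C * SB := by
    have s1 : Summable fun l : ℤ × ℤ => (if |euclLength (latticeToPlane l) - R| < a then
        F (euclLength (latticeToPlane l) - R, direction (latticeToPlane l)) else 0) :=
      summable_of_annulus 0 R a fun l hl => if_neg (by rw [add_zero] at hl; exact hl.not_gt)
    have s2 := summable_annulusSum hA0 R 0
    have s3 := summable_annulusSum hB0 R 0
    simp only [hSA, hSB, hSF, annulusSum]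
    simp only [add_zero] at s2 s3 ⊢
    rw [← s1.tsum_sub s2, ← tsum_mul_left, ← Real.norm_eq_abs]
    refine tsum_of_norm_bounded (s3.mul_left C).hasSum fun l => ?_
    rw [Real.norm_eq_abs]
    by_cases h : |euclLength (latticeToPlane l) - R| ≤ a + 2 * δ
    · exact hpt _ _ (direction_mem_planeCircle (pos_euclLength_of_abs_sub_le h hRa))
    · rw [hA0 _ _ (by linarith), if_neg (by linarith), sub_zero, abs_zero]
      exact mul_nonneg hC0 (edgeBump_nonneg _ _ _)
  have hsum' : |R⁻¹ * SF - R⁻¹ * SA| ≤ C * (R⁻¹ * SB) := by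
    rw [← mul_sub, abs_mul, abs_inv, abs_of_pos hR0]
    calc R⁻¹ * |SF - SA| ≤ R⁻¹ * (C * SB) := by gcongr
      _ = _ := by ring
  rw [Real.dist_eq] at hRA hRB ⊢
  have hδ' : (C + 1) * (16 * Real.pi * δ) = κ / 8 := by rw [hδ]; field_simp
  set IB := ∫ p in univ ×ˢ Ioo (-Real.pi) Real.pi, B (p.1, circlePoint p.2)
  have b1 : C * IB ≤ κ / 8 := by
    calc C * IB ≤ C * (16 * Real.pi * δ) := by gcongr
      _ ≤ (C + 1) * (16 * Real.pi * δ) := by gcongr; linarith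
      _ = _ := hδ'
  have b2 : C * (R⁻¹ * SB) ≤ κ / 8 + κ / 8 := by
    have h := (abs_lt.mp hRB).2
    have h' : C * (κ / (8 * (C + 1))) ≤ κ / 8 := by
      calc C * (κ / (8 * (C + 1))) ≤ (C + 1) * (κ / (8 * (C + 1))) := by gcongr; linarith
        _ = κ / 8 := by field_simp
    have : C * (R⁻¹ * SB) ≤ C * (IB + κ / (8 * (C + 1))) := by gcongr; linarith
    linarith
  rw [abs_le] at hI hsum'
  rw [abs_lt] at hRA ⊢
  constructor <;> linarith

end Cutoff

/-! ### Half-plane areas and the comparison with the disc -/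

/-- The area of the part of the unit square on which `r + u · s` is nonpositive. -/
noncomputable def halfArea (r : ℝ) (u : ℝ × ℝ) : ℝ :=
  volume.real (unitSquare ∩ {s | r + dotProd u s ≤ 0})

section HalfArea

theorem measurableSet_unitSquare : MeasurableSet unitSquare :=
  measurableSet_Icc.prod measurableSet_Icc

theorem volume_unitSquare : volume unitSquare = 1 := by
  rw [unitSquare, Measure.volume_eq_prod, Measure.prod_prod, Real.volume_Icc]; norm_num

instance : IsProbabilityMeasure ((volume : Measure (ℝ × ℝ)).restrict unitSquare) :=
  ⟨by rw [Measure.restrict_apply_univ, volume_unitSquare]⟩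

theorem euclLength_le_of_mem_unitSquare {s : ℝ × ℝ} (hs : s ∈ unitSquare) :
    euclLength s ≤ 1 / Real.sqrt 2 := by
  obtain ⟨⟨h1, h2⟩, h3, h4⟩ := hs
  rw [euclLength, Real.sqrt_le_left (by positivity), div_pow, Real.sq_sqrt (by norm_num)]
  nlinarith

theorem continuous_dotProd_left (u : ℝ × ℝ) : Continuous (dotProd u) := by
  unfold dotProd; fun_prop

theorem measurableSet_halfPlane (r : ℝ) (u : ℝ × ℝ) :
    MeasurableSet {s | r + dotProd u s ≤ 0} :=
  (isClosed_le ((continuous_dotProd_left u).const_add r) continuous_const).measurableSet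

theorem halfArea_eq_integral (r : ℝ) (u : ℝ × ℝ) :
    halfArea r u = ∫ s in unitSquare, {s | r + dotProd u s ≤ 0}.indicator (fun _ => (1 : ℝ)) s := by
  rw [integral_indicator (measurableSet_halfPlane r u), Measure.restrict_restrict
    (measurableSet_halfPlane r u), setIntegral_const, smul_eq_mul, mul_one, halfArea, inter_comm]

theorem halfArea_mem_Icc (r : ℝ) (u : ℝ × ℝ) : halfArea r u ∈ Icc (0 : ℝ) 1 := by
  refine ⟨measureReal_nonneg, ?_⟩
  calc halfArea r u ≤ volume.real unitSquare :=
        measureReal_mono inter_subset_left (by simp [volume_unitSquare])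
    _ = 1 := by rw [measureReal_def, volume_unitSquare]; simp

/-- Lines are null sets. -/
theorem volume_line_eq_zero {u : ℝ × ℝ} (hu : u ∈ planeCircle) (r : ℝ) :
    volume {s | r + dotProd u s = 0} = 0 := by
  have hm : MeasurableSet {s | r + dotProd u s = 0} :=
    (isClosed_eq ((continuous_dotProd_left u).const_add r) continuous_const).measurableSet
  have hu : u.1 ^ 2 + u.2 ^ 2 = 1 := hu
  by_cases h : u.2 = 0
  · have h1 : u.1 ≠ 0 := by intro h1; rw [h, h1] at hu; norm_num at hu
    rw [Measure.volume_eq_prod] at *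
    rw [Measure.measure_prod_null hm]
    have hn : ∀ᵐ x : ℝ, x ≠ -r / u.1 := by simp [ae_iff]
    filter_upwards [hn] with x hx
    have : Prod.mk x ⁻¹' {s | r + dotProd u s = 0} = ∅ := by
      refine eq_empty_of_forall_notMem fun y (hy : _ = _) => hx ?_
      simp only [dotProd, h] at hy
      field_simp; linarith
    rw [this]; simp
  · rw [Measure.volume_eq_prod] at *
    rw [Measure.measure_prod_null hm]
    refine ae_of_all _ fun x => ?_
    refine measure_mono_null (t := {(-r - u.1 * x) / u.2}) (fun y (hy : _ = _) => ?_) (by simp)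
    simp only [dotProd] at hy
    rw [mem_singleton_iff]
    field_simp; linarith

/-- The indicator of the half-plane is continuous in the parameters except at points `s` of the
boundary line, a null set as `u` is a unit vector. Dominated convergence does the rest. -/
theorem continuousOn_halfArea :
    ContinuousOn (fun p : ℝ × (ℝ × ℝ) => halfArea p.1 p.2) (univ ×ˢ planeCircle) := by
  rintro ⟨r, u⟩ ⟨-, hu⟩
  simp only [ContinuousWithinAt, halfArea_eq_integral]
  refine tendsto_integral_filter_of_dominated_convergence (fun _ => 1) ?_ ?_
    (integrable_const _) ?_
  · exact Eventually.of_forall fun p =>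
      (measurable_const.indicator (measurableSet_halfPlane _ _)).aestronglyMeasurable
  · refine Eventually.of_forall fun p => ae_of_all _ fun s => ?_
    rw [Real.norm_eq_abs, abs_of_nonneg (indicator_nonneg (fun _ _ => zero_le_one) _)]
    exact indicator_le_self' (fun _ _ => zero_le_one) _
  · have hn : ∀ᵐ s ∂volume.restrict unitSquare, r + dotProd u s ≠ 0 :=
      ae_restrict_of_ae (by rw [ae_iff]; simpa using volume_line_eq_zero hu r)
    filter_upwards [hn] with s hs
    have hc : Continuous fun p : ℝ × (ℝ × ℝ) => p.1 + dotProd p.2 s := by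
      unfold dotProd; fun_prop
    refine Tendsto.congr' ?_ tendsto_const_nhds
    have hc' := (hc.continuousAt (x := (r, u))).continuousWithinAt (s := univ ×ˢ planeCircle)
    rcases lt_or_gt_of_ne hs with h | h
    · filter_upwards [hc'.eventually_lt_const h] with p hp
      rw [indicator_of_mem (by exact h.le), indicator_of_mem (by exact hp.le)]
    · filter_upwards [hc'.eventually_const_lt h] with p hp
      rw [indicator_of_notMem (by exact not_le.mpr h), indicator_of_notMem (by exact not_le.mpr hp)]

/-- The square is symmetric under reflection. This is needed because the first coordinate of `tilt θ
s` pairs `s` with `(cos θ, -sin θ)`, not with `circlePoint θ`. -/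
theorem halfArea_neg_snd (r a b : ℝ) : halfArea r (a, -b) = halfArea r (a, b) := by
  have hmp : MeasurePreserving (Prod.map id Neg.neg : ℝ × ℝ → ℝ × ℝ) :=
    (MeasurePreserving.id volume).prod (Measure.measurePreserving_neg volume)
  have hm : MeasurableSet (unitSquare ∩ {s | r + dotProd (a, b) s ≤ 0}) :=
    measurableSet_unitSquare.inter (measurableSet_halfPlane _ _)
  rw [halfArea, halfArea, measureReal_def, measureReal_def,
    ← hmp.measure_preimage hm.nullMeasurableSet]
  congr 2
  ext s
  simp only [unitSquare, dotProd, mem_inter_iff, mem_prod, mem_Icc, mem_ofPred_eq, mem_preimage,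
    Prod.map_fst, Prod.map_snd, id_eq]
  constructor
  · rintro ⟨⟨h1, h2, h3⟩, h4⟩
    exact ⟨⟨h1, by linarith, by linarith⟩, by linarith⟩
  · rintro ⟨⟨h1, h2, h3⟩, h4⟩
    exact ⟨⟨h1, by linarith, by linarith⟩, by linarith⟩

/-- The linear map given by the rotation by `θ`. -/
noncomputable def tiltLinear (θ : ℝ) : (ℝ × ℝ) →ₗ[ℝ] (ℝ × ℝ) :=
  Matrix.toLin (Module.Basis.finTwoProd ℝ) (Module.Basis.finTwoProd ℝ)
    !![Real.cos θ, -Real.sin θ; Real.sin θ, Real.cos θ]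

theorem tiltLinear_apply (θ : ℝ) (p : ℝ × ℝ) : tiltLinear θ p = tilt θ p := by
  rw [tiltLinear, Matrix.toLin_finTwoProd_apply, tilt]
  ext <;> simp only
  ring

theorem volume_image_tilt (θ : ℝ) (s : Set (ℝ × ℝ)) : volume (tilt θ '' s) = volume s := by
  have h : LinearMap.det (tiltLinear θ) = 1 := by
    rw [tiltLinear, LinearMap.det_toLin, Matrix.det_fin_two_of]
    have := Real.cos_sq_add_sin_sq θ
    linarith
  have := Measure.addHaar_image_linearMap volume (tiltLinear θ) s
  rw [h, abs_one, ENNReal.ofReal_one, one_mul] at this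
  rw [← this]
  congr 1
  exact image_congr fun p _ => (tiltLinear_apply θ p).symm

theorem areaLeft_eq_halfArea (q : ℝ × ℝ) : areaLeft q = halfArea q.1 (circlePoint q.2) := by
  rw [circlePoint, ← halfArea_neg_snd, areaLeft, halfArea, tiltedSquare, ← image_inter_preimage,
    ← image_inter_preimage, measureReal_def, measureReal_def, image_add_left, measure_preimage_add,
    volume_image_tilt]
  congr 3
  ext s
  simp only [mem_preimage, mem_ofPred_eq, dotProd, tilt, Prod.fst_add]
  rw [sub_eq_add_neg, neg_mul]

theorem areaInDisc_eq (R : ℝ) (l : ℤ × ℤ) :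
    areaInDisc R l = volume.real (unitSquare ∩ {s | euclLength (latticeToPlane l + s) < R}) := by
  rw [areaInDisc, ← image_inter_preimage, measureReal_def, measureReal_def, image_add_left,
    measure_preimage_add]
  rfl

theorem areaInDisc_mem_Icc (R : ℝ) (l : ℤ × ℤ) : areaInDisc R l ∈ Icc (0 : ℝ) 1 := by
  rw [areaInDisc_eq]
  refine ⟨measureReal_nonneg, ?_⟩
  calc _ ≤ volume.real unitSquare :=
        measureReal_mono inter_subset_left (by simp [volume_unitSquare])
    _ = 1 := by rw [measureReal_def, volume_unitSquare]; simp

/-- The disc lies on one side of its tangent line orthogonal to the direction of `l`. -/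
theorem areaInDisc_le_halfArea {R : ℝ} {l : ℤ × ℤ} (hl : 0 < euclLength (latticeToPlane l)) :
    areaInDisc R l ≤ halfArea (euclLength (latticeToPlane l) - R)
      (direction (latticeToPlane l)) := by
  rw [areaInDisc_eq]
  refine measureReal_mono ?_
    ((measure_mono inter_subset_left).trans_lt (by simp [volume_unitSquare])).ne
  rintro s ⟨hs1, hs⟩
  refine ⟨hs1, ?_⟩
  have := add_dotProd_le_euclLength_add hl s
  rw [mem_ofPred_eq] at hs ⊢
  linarith

theorem halfArea_le_areaInDisc {R : ℝ} {l : ℤ × ℤ} (hl : 0 < euclLength (latticeToPlane l)) :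
    halfArea (euclLength (latticeToPlane l) - R + 1 / euclLength (latticeToPlane l))
      (direction (latticeToPlane l)) ≤ areaInDisc R l := by
  rw [areaInDisc_eq]
  refine measureReal_mono ?_
    ((measure_mono inter_subset_left).trans_lt (by simp [volume_unitSquare])).ne
  rintro s ⟨hs1, hs⟩
  refine ⟨hs1, ?_⟩
  rw [mem_ofPred_eq] at hs ⊢
  have h1 := euclLength_add_le_dotProd hl s
  have h2 := euclLength_le_of_mem_unitSquare hs1
  have h3 : euclLength s ^ 2 ≤ 1 / 2 := by
    calc _ ≤ (1 / Real.sqrt 2) ^ 2 := by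
          have := euclLength_nonneg s
          gcongr
      _ = 1 / 2 := by rw [div_pow, Real.sq_sqrt (by norm_num)]; norm_num
  -- The quadratic remainder is at most `1 / (4‖l‖)`; the generous `1 / ‖l‖` makes it strict, as the
  -- open disc requires.
  have h4 : euclLength s ^ 2 / (2 * euclLength (latticeToPlane l)) <
      1 / euclLength (latticeToPlane l) := by
    rw [div_lt_div_iff₀ (by positivity) hl]
    nlinarith
  linarith

theorem abs_sub_lt_of_mem_annulusLattice {R : ℝ} {l : ℤ × ℤ} :
    l ∈ annulusLattice R ↔ |euclLength (latticeToPlane l) - R| < 1 / Real.sqrt 2 := by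
  rw [annulusLattice, mem_ofPred_eq, abs_lt]
  constructor <;> rintro ⟨h1, h2⟩ <;> constructor <;> linarith

theorem one_div_sqrt_two_le_one : 1 / Real.sqrt 2 ≤ 1 := by
  rw [div_le_one (by positivity)]
  exact Real.one_le_sqrt.mpr (by norm_num)

/-- The area is squeezed between the half-plane areas at `r` and `r + 1 / ‖l‖`, and these merge by
uniform continuity. The compact range `[-2, 2]` contains both arguments. -/
theorem eventually_abs_areaInDisc_sub_lt {η : ℝ} (hη : 0 < η) :
    ∀ᶠ R in atTop, ∀ l ∈ annulusLattice R, |areaInDisc R l -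
      halfArea (euclLength (latticeToPlane l) - R) (direction (latticeToPlane l))| < η := by
  have hK := (isCompact_Icc (a := (-2 : ℝ)) (b := 2)).prod isCompact_planeCircle
  obtain ⟨δ, hδ, h⟩ := Metric.uniformContinuousOn_iff.mp
    (hK.uniformContinuousOn_of_continuous
      (continuousOn_halfArea.mono (prod_mono_left (subset_univ _)))) η hη
  filter_upwards [eventually_gt_atTop (1 + 1 / δ), eventually_gt_atTop 2] with R hR hR2 l hl
  rw [abs_sub_lt_of_mem_annulusLattice] at hl
  have hl1 := (hl.trans_le one_div_sqrt_two_le_one)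
  have hl2 := abs_lt.mp hl1
  have hδ' : 0 < 1 / δ := by positivity
  have hx : 0 < euclLength (latticeToPlane l) := by linarith
  have hu := direction_mem_planeCircle hx
  set n := euclLength (latticeToPlane l)
  have h1 := areaInDisc_le_halfArea (R := R) hx
  have h2 := halfArea_le_areaInDisc (R := R) hx
  have h4 : 1 / n < δ := by
    rw [div_lt_iff₀ hx]
    have : 1 / δ < n := by linarith
    rw [div_lt_iff₀ hδ] at this
    linarith
  have h5 : 1 / n ≤ 1 := by rw [div_le_one hx]; linarith
  have h6 : 0 < 1 / n := by positivity
  have h3 := h (n - R, direction (latticeToPlane l)) ⟨⟨by linarith, by linarith⟩, hu⟩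
    (n - R + 1 / n, direction (latticeToPlane l)) ⟨⟨by linarith, by linarith⟩, hu⟩
    (by rw [Prod.dist_eq, dist_self, Real.dist_eq, max_lt_iff]
        refine ⟨?_, hδ⟩
        rw [show n - R - (n - R + 1 / n) = -(1 / n) by ring, abs_neg, abs_of_pos h6]
        exact h4)
  rw [Real.dist_eq] at h3
  have h7 := abs_lt.mp h3
  simp only at h7
  rw [abs_lt]
  constructor <;> linarith

end HalfArea

/-! ### Integration over the parameter rectangle -/

section ParamIntegral

theorem continuous_areaLeft : Continuous areaLeft := by
  have h : areaLeft = fun q => halfArea q.1 (circlePoint q.2) := funext areaLeft_eq_halfArea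
  rw [h]
  exact continuous_radial continuousOn_halfArea

theorem volume_real_paramRect :
    volume.real paramRect = 2 * (1 / Real.sqrt 2) * (2 * Real.pi) := by
  have := Real.pi_pos
  rw [measureReal_def, volume_paramRect, ENNReal.toReal_mul, ENNReal.toReal_ofReal (by positivity),
    ENNReal.toReal_ofReal (by positivity)]

/-- Periodicity moves the angle from `[0, 2π)` to `(-π, π)`, the range of the polar coordinates. -/
theorem integral_paramUniform {h : ℝ × ℝ → ℝ} (hc : Continuous h)
    (hp : ∀ r, Function.Periodic (fun θ => h (r, θ)) (2 * Real.pi)) :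
    ∫ q, h q ∂paramUniform = (volume.real paramRect)⁻¹ *
      ∫ q in Ioo (-(1 / Real.sqrt 2)) (1 / Real.sqrt 2) ×ˢ Ioo (-Real.pi) Real.pi, h q := by
  have hpi := Real.pi_pos
  have hi : IntegrableOn h (Icc (-(1 / Real.sqrt 2)) (1 / Real.sqrt 2) ×ˢ
      Icc (-(2 * Real.pi)) (2 * Real.pi)) :=
    hc.continuousOn.integrableOn_compact (isCompact_Icc.prod isCompact_Icc)
  rw [paramUniform, ProbabilityTheory.cond, integral_smul_measure, smul_eq_mul, ENNReal.toReal_inv,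
    measureReal_def]
  congr 1
  rw [paramRect, Measure.volume_eq_prod, setIntegral_prod, setIntegral_prod,
    integral_Icc_eq_integral_Ioo]
  · refine setIntegral_congr_fun measurableSet_Ioo fun r _ => ?_
    rw [integral_Ico_eq_integral_Ioc, ← integral_Ioc_eq_integral_Ioo,
      ← intervalIntegral.integral_of_le (by linarith),
      ← intervalIntegral.integral_of_le (by linarith)]
    have := (hp r).intervalIntegral_add_eq 0 (-Real.pi)
    rwa [zero_add, show -Real.pi + 2 * Real.pi = Real.pi by ring] at this
  · exact hi.mono_set (prod_mono Ioo_subset_Icc_self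
      (Ioo_subset_Icc_self.trans (Icc_subset_Icc (by linarith) (by linarith))))
  · exact hi.mono_set (prod_mono_right
      (Ico_subset_Icc_self.trans (Icc_subset_Icc (by linarith) le_rfl)))

theorem areaLeft_periodic (r : ℝ) :
    Function.Periodic (fun θ => areaLeft (r, θ)) (2 * Real.pi) := fun θ => by
  simp only [areaLeft_eq_halfArea, circlePoint, Real.cos_add_two_pi, Real.sin_add_two_pi]

end ParamIntegral

/-! ### Convergence in distribution -/

section Convergence

theorem tsum_annulusLattice (R : ℝ) (f : ℤ × ℤ → ℝ) :
    ∑' l : ℤ × ℤ, (if |euclLength (latticeToPlane l) - R| < 1 / Real.sqrt 2 then f l else 0) =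
      ∑ l ∈ (annulusLattice_finite R).toFinset, f l := by
  rw [tsum_eq_sum (s := (annulusLattice_finite R).toFinset)]
  · refine Finset.sum_congr rfl fun l hl => if_pos ?_
    rwa [Set.Finite.mem_toFinset, abs_sub_lt_of_mem_annulusLattice] at hl
  · intro l hl
    rw [Set.Finite.mem_toFinset, abs_sub_lt_of_mem_annulusLattice] at hl
    exact if_neg hl

/-- Equidistribution for the constant 1; it provides the normalization. -/
theorem tendsto_card_annulusLattice :
    Tendsto (fun R => R⁻¹ * ((annulusLattice_finite R).toFinset.card : ℝ)) atTop
      (𝓝 (volume.real paramRect)) := by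
  have hpi := Real.pi_pos
  have h := tendsto_tsum_annulus (F := fun _ => 1) (a := 1 / Real.sqrt 2) (C := 1)
    continuousOn_const (by positivity) zero_le_one (fun _ _ _ => by simp)
  have e : ∫ _ in Ioo (-(1 / Real.sqrt 2)) (1 / Real.sqrt 2) ×ˢ Ioo (-Real.pi) Real.pi, (1 : ℝ) =
      volume.real paramRect := by
    have h0 : -(1 / Real.sqrt 2) ≤ 1 / Real.sqrt 2 := by
      have : 0 < 1 / Real.sqrt 2 := by positivity
      linarith
    rw [setIntegral_const, smul_eq_mul, mul_one, Measure.volume_eq_prod, measureReal_prod_prod,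
      ← Measure.volume_eq_prod, volume_real_paramRect, Real.volume_real_Ioo_of_le h0,
      Real.volume_real_Ioo_of_le (by linarith)]
    ring
  rw [e] at h
  refine h.congr fun R => ?_
  rw [tsum_annulusLattice R (fun _ => 1)]
  simp

/-- Equidistribution applies to `φ` of the half-plane area. Passing to the disc area costs a
uniformly small error at each of `O(R)` points. -/
theorem tendsto_sum_areaInDisc {φ : ℝ → ℝ} (hφ : Continuous φ) :
    Tendsto (fun R => R⁻¹ * ∑ l ∈ (annulusLattice_finite R).toFinset, φ (areaInDisc R l)) atTop
      (𝓝 (∫ q in Ioo (-(1 / Real.sqrt 2)) (1 / Real.sqrt 2) ×ˢ Ioo (-Real.pi) Real.pi,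
        φ (areaLeft q))) := by
  obtain ⟨C, hC⟩ := (isCompact_Icc (a := (0 : ℝ)) (b := 1)).exists_bound_of_continuousOn
    hφ.continuousOn
  have h := tendsto_tsum_annulus (F := fun p => φ (halfArea p.1 p.2)) (a := 1 / Real.sqrt 2)
    (C := C) (hφ.comp_continuousOn continuousOn_halfArea) (by positivity)
    ((norm_nonneg _).trans (hC 0 (by simp))) (fun r u _ => hC _ (halfArea_mem_Icc r u))
  simp_rw [areaLeft_eq_halfArea]
  suffices hd : Tendsto (fun R => R⁻¹ * ∑ l ∈ (annulusLattice_finite R).toFinset,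
      (φ (areaInDisc R l) - φ (halfArea (euclLength (latticeToPlane l) - R)
        (direction (latticeToPlane l))))) atTop (𝓝 0) by
    have := hd.add h
    rw [zero_add] at this
    refine this.congr fun R => ?_
    rw [tsum_annulusLattice R (fun l => φ (halfArea (euclLength (latticeToPlane l) - R)
      (direction (latticeToPlane l)))), ← mul_add, ← Finset.sum_add_distrib]
    simp
  rw [Metric.tendsto_nhds]
  intro κ hκ
  set V := volume.real paramRect
  have hV : 0 ≤ V := measureReal_nonneg
  obtain ⟨η, hη, hη'⟩ := Metric.uniformContinuousOn_iff.mp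
    ((isCompact_Icc (a := (0 : ℝ)) (b := 1)).uniformContinuousOn_of_continuous hφ.continuousOn)
    (κ / (V + 1)) (by positivity)
  filter_upwards [eventually_abs_areaInDisc_sub_lt hη, eventually_gt_atTop 0,
    tendsto_card_annulusLattice.eventually_lt_const (lt_add_one V)] with R hR hR0 hc
  rw [Real.dist_eq, sub_zero, abs_mul, abs_inv, abs_of_pos hR0]
  calc R⁻¹ * |∑ l ∈ (annulusLattice_finite R).toFinset, _|
      ≤ R⁻¹ * ∑ l ∈ (annulusLattice_finite R).toFinset, κ / (V + 1) := by
        gcongr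
        refine (Finset.abs_sum_le_sum_abs _ _).trans (Finset.sum_le_sum fun l hl => ?_)
        exact (hη' _ (areaInDisc_mem_Icc R l) _ (halfArea_mem_Icc _ _)
          (hR l ((Set.Finite.mem_toFinset _).mp hl))).le
    _ = R⁻¹ * ((annulusLattice_finite R).toFinset.card : ℝ) * (κ / (V + 1)) := by
        rw [Finset.sum_const, nsmul_eq_mul]; ring
    _ < (V + 1) * (κ / (V + 1)) := by gcongr
    _ = κ := by field_simp

theorem integral_latticeUniform (R : Ioi (0 : ℝ)) (f : ℤ × ℤ → ℝ) :
    ∫ l, f l ∂latticeUniform R =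
      ((annulusLattice_finite R).toFinset.card : ℝ)⁻¹ *
        ∑ l ∈ (annulusLattice_finite R).toFinset, f l := by
  have hfin := annulusLattice_finite R
  have hcount : Measure.count (annulusLattice (R : ℝ)) = hfin.toFinset.card :=
    Measure.count_apply_finite _ hfin
  have hs : annulusLattice (R : ℝ) = (hfin.toFinset : Set (ℤ × ℤ)) := by simp
  rw [latticeUniform, uniformOn, ProbabilityTheory.cond, integral_smul_measure, hcount, smul_eq_mul]
  congr 1
  · simp
  · conv_lhs => rw [hs]
    rw [setIntegral_finset]
    · simp
    · rw [← biUnion_of_singleton (hfin.toFinset : Set (ℤ × ℤ))]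
      exact (integrableOn_finite_biUnion hfin.toFinset.finite_toSet).mpr fun l _ => by simp

theorem tendstoInDistribution_areaInDisc :
    TendstoInDistribution (fun R : Ioi (0 : ℝ) => areaInDisc (R : ℝ)) atTop areaLeft
      latticeUniform paramUniform where
  forall_aemeasurable := fun R => (measurable_of_countable _).aemeasurable
  aemeasurable_limit := continuous_areaLeft.measurable.aemeasurable
  tendsto := by
    have hV : volume.real paramRect ≠ 0 := by
      have := Real.pi_pos
      rw [volume_real_paramRect]; positivity
    refine ProbabilityMeasure.tendsto_iff_forall_integral_tendsto.mpr fun φ => ?_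
    simp only [ProbabilityMeasure.coe_mk]
    rw [integral_map continuous_areaLeft.measurable.aemeasurable
      φ.continuous.aestronglyMeasurable]
    -- Sum and count are both divided by `R`, so that each has a finite limit.
    have e : ∀ R : Ioi (0 : ℝ), ∫ x, φ x ∂((latticeUniform R).map (areaInDisc R)) =
        ((R : ℝ)⁻¹ * ((annulusLattice_finite R).toFinset.card : ℝ))⁻¹ *
          ((R : ℝ)⁻¹ * ∑ l ∈ (annulusLattice_finite R).toFinset, φ (areaInDisc R l)) := by
      intro R
      have hR : (R : ℝ) ≠ 0 := (show (0 : ℝ) < R from R.2).ne'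
      rw [integral_map (measurable_of_countable _).aemeasurable
        φ.continuous.aestronglyMeasurable, integral_latticeUniform]
      field_simp
    simp_rw [e]
    rw [integral_paramUniform (h := fun q => φ (areaLeft q)) (φ.continuous.comp continuous_areaLeft)
      (fun r => (areaLeft_periodic r).comp φ)]
    exact tendsto_comp_val_Ioi_atTop.mpr
      ((tendsto_card_annulusLattice.inv₀ hV).mul (tendsto_sum_areaInDisc φ.continuous))

end Convergence

/-! ### Averages of `|z|` as iterated central differences -/

section CentralDifference

/-- The central difference quotient of width `k`. -/
noncomputable def centralDiff (k : ℝ) (f : ℝ → ℝ) (z : ℝ) : ℝ := (f (z + k / 2) - f (z - k / 2)) / k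

theorem HasDerivAt.centralDiff {F f : ℝ → ℝ} (h : ∀ z, HasDerivAt F (f z) z) (k z : ℝ) :
    HasDerivAt (centralDiff k F) (centralDiff k f z) z :=
  (((h (z + k / 2)).comp_add_const z (k / 2)).sub
    ((h (z - k / 2)).comp_sub_const z (k / 2))).div_const k

theorem Continuous.centralDiff {f : ℝ → ℝ} (h : Continuous f) (k : ℝ) :
    Continuous (centralDiff k f) := by
  unfold _root_.centralDiff; fun_prop

theorem integral_comp_add_mul_eq_centralDiff {F f : ℝ → ℝ} (h : ∀ z, HasDerivAt F (f z) z)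
    (hf : Continuous f) {k : ℝ} (hk : k ≠ 0) (b : ℝ) :
    ∫ t in (-(1 / 2) : ℝ)..1 / 2, f (b + k * t) = centralDiff k F b := by
  rw [intervalIntegral.integral_comp_add_mul _ hk, smul_eq_mul,
    intervalIntegral.integral_eq_sub_of_hasDerivAt (fun z _ => h z) (hf.intervalIntegrable _ _),
    centralDiff, inv_mul_eq_div]
  congr 3 <;> ring

theorem integral_comp_sub_mul_eq_centralDiff {F f : ℝ → ℝ} (h : ∀ z, HasDerivAt F (f z) z)
    (hf : Continuous f) {k : ℝ} (hk : k ≠ 0) (b : ℝ) :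
    ∫ t in (-(1 / 2) : ℝ)..1 / 2, f (b - k * t) = centralDiff k F b := by
  have := integral_comp_add_mul_eq_centralDiff h hf (neg_ne_zero.mpr hk) b
  simp only [neg_mul, ← sub_eq_add_neg] at this
  rw [this, centralDiff, centralDiff, neg_div, ← sub_eq_add_neg, sub_neg_eq_add, div_neg, ← neg_div,
    neg_sub]

theorem hasDerivAt_mul_abs (z : ℝ) : HasDerivAt (fun z : ℝ => z * |z|) (2 * |z|) z := by
  rcases lt_trichotomy z 0 with h | rfl | h
  · refine ((hasDerivAt_id z).mul (hasDerivAt_abs_neg h)).congr_deriv ?_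
    simp only [abs_of_neg h, id]; ring
  · rw [hasDerivAt_iff_tendsto_slope_zero]
    have h0 : Tendsto (fun t : ℝ => |t|) (𝓝[≠] 0) (𝓝 (2 * |0|)) := by
      have := (continuous_abs (G := ℝ)).tendsto 0
      simp only [abs_zero, mul_zero] at this ⊢
      exact this.mono_left nhdsWithin_le_nhds
    refine h0.congr' ?_
    filter_upwards [self_mem_nhdsWithin] with t ht
    have ht : t ≠ 0 := ht
    simp only [zero_add, abs_zero, mul_zero, sub_zero, smul_eq_mul]
    field_simp
  · refine ((hasDerivAt_id z).mul (hasDerivAt_abs_pos h)).congr_deriv ?_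
    simp only [abs_of_pos h, id]; ring

theorem hasDerivAt_pow_mul_abs (n : ℕ) (z : ℝ) :
    HasDerivAt (fun z : ℝ => z ^ (n + 1) * |z|) ((n + 2) * (z ^ n * |z|)) z := by
  induction n with
  | zero => simpa using hasDerivAt_mul_abs z
  | succ n ih =>
    have := (hasDerivAt_id z).mul ih
    have e : (fun z : ℝ => z ^ (n + 1 + 1) * |z|) = id * fun z : ℝ => z ^ (n + 1) * |z| := by
      ext z; simp only [Pi.mul_apply, id]; ring
    rw [e]
    refine this.congr_deriv ?_
    simp only [id]; push_cast; ring

/-- The stencil is the product of the second differences `(1, -2, 1)` of steps `c` and `d`; evenness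
folds its nine points into five values. -/
theorem centralDiff_four_of_even {P : ℝ → ℝ} (hP : ∀ z, P (-z) = P z) (c d : ℝ) :
    centralDiff c (centralDiff d (centralDiff c (centralDiff d P))) 0 =
      (2 * P (c + d) + 2 * P (c - d) - 4 * P c - 4 * P d + 4 * P 0) / (c ^ 2 * d ^ 2) := by
  have e1 := hP (c + d)
  have e2 := hP (c - d)
  have e3 := hP c
  have e4 := hP d
  simp only [centralDiff]
  ring_nf at e1 e2 e3 e4 ⊢
  simp only [e1, e2, e3, e4]
  ring

/-- The mean of `|c * (x - x') + d * (y - y')|` over the unit square. -/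
theorem integral_abs_four {c d : ℝ} (hc : c ≠ 0) (hd : d ≠ 0) :
    ∫ x in (-(1 / 2) : ℝ)..1 / 2, ∫ y in (-(1 / 2) : ℝ)..1 / 2,
      ∫ x' in (-(1 / 2) : ℝ)..1 / 2, ∫ y' in (-(1 / 2) : ℝ)..1 / 2,
        |c * x + d * y - (c * x' + d * y')| =
      ((c + d) ^ 4 * |c + d| + (c - d) ^ 4 * |c - d| - 2 * (c ^ 4 * |c|) - 2 * (d ^ 4 * |d|)) /
        (60 * (c ^ 2 * d ^ 2)) := by
  -- Iterated antiderivatives of `|z|`. Each of the four averages turns `f` into a central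
  -- difference of its antiderivative.
  set P0 : ℝ → ℝ := fun z => |z| with hP0
  set P1 : ℝ → ℝ := fun z => z ^ (0 + 1) * |z| / 2 with hP1
  set P2 : ℝ → ℝ := fun z => z ^ (1 + 1) * |z| / 6 with hP2
  set P3 : ℝ → ℝ := fun z => z ^ (2 + 1) * |z| / 24 with hP3
  set P4 : ℝ → ℝ := fun z => z ^ (3 + 1) * |z| / 120 with hP4
  have c0 : Continuous P0 := by fun_prop
  have c1 : Continuous P1 := by fun_prop
  have c2 : Continuous P2 := by fun_prop
  have c3 : Continuous P3 := by fun_prop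
  have d1 : ∀ z, HasDerivAt P1 (P0 z) z := fun z => by
    refine ((hasDerivAt_pow_mul_abs 0 z).div_const 2).congr_deriv ?_
    simp only [hP0]; push_cast; ring
  have d2 : ∀ z, HasDerivAt P2 (P1 z) z := fun z => by
    refine ((hasDerivAt_pow_mul_abs 1 z).div_const 6).congr_deriv ?_
    simp only [hP1]; push_cast; ring
  have d3 : ∀ z, HasDerivAt P3 (P2 z) z := fun z => by
    refine ((hasDerivAt_pow_mul_abs 2 z).div_const 24).congr_deriv ?_
    simp only [hP2]; push_cast; ring
  have d4 : ∀ z, HasDerivAt P4 (P3 z) z := fun z => by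
    refine ((hasDerivAt_pow_mul_abs 3 z).div_const 120).congr_deriv ?_
    simp only [hP3]; push_cast; ring
  have s1 : ∀ x y x' : ℝ, ∫ y' in (-(1 / 2) : ℝ)..1 / 2, |c * x + d * y - (c * x' + d * y')| =
      centralDiff d P1 (c * x + d * y - c * x') := fun x y x' => by
    rw [← integral_comp_sub_mul_eq_centralDiff d1 c0 hd]
    simp only [hP0, sub_sub]
  have s2 : ∀ x y : ℝ, ∫ x' in (-(1 / 2) : ℝ)..1 / 2, centralDiff d P1 (c * x + d * y - c * x') =
      centralDiff c (centralDiff d P2) (c * x + d * y) := fun x y =>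
    integral_comp_sub_mul_eq_centralDiff (HasDerivAt.centralDiff d2 d) (c1.centralDiff d) hc _
  have s3 : ∀ x : ℝ, ∫ y in (-(1 / 2) : ℝ)..1 / 2,
      centralDiff c (centralDiff d P2) (c * x + d * y) =
      centralDiff d (centralDiff c (centralDiff d P3)) (0 + c * x) := fun x => by
    rw [zero_add]
    exact integral_comp_add_mul_eq_centralDiff
      (HasDerivAt.centralDiff (HasDerivAt.centralDiff d3 d) c)
      ((c2.centralDiff d).centralDiff c) hd _
  simp only [s1, s2, s3]
  rw [integral_comp_add_mul_eq_centralDiff (HasDerivAt.centralDiff (HasDerivAt.centralDiff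
    (HasDerivAt.centralDiff d4 d) c) d) (((c3.centralDiff d).centralDiff c).centralDiff d) hc,
    centralDiff_four_of_even]
  · simp only [hP4]
    field_simp
    simp only [abs_zero]
    ring
  · intro z
    simp only [hP4, abs_neg]; ring

end CentralDifference

/-! ### First and second radial moments of the half-plane area -/

section SquareIntegrals

theorem integral_unitSquare {f : ℝ × ℝ → ℝ} (hf : Continuous f) :
    ∫ s in unitSquare, f s =
      ∫ x in (-(1 / 2) : ℝ)..1 / 2, ∫ y in (-(1 / 2) : ℝ)..1 / 2, f (x, y) := by
  have hi : IntegrableOn f unitSquare :=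
    hf.continuousOn.integrableOn_compact (isCompact_Icc.prod isCompact_Icc)
  rw [unitSquare, Measure.volume_eq_prod, setIntegral_prod _ hi]
  simp only [integral_Icc_eq_integral_Ioc]
  rw [intervalIntegral.integral_of_le (by norm_num)]
  refine setIntegral_congr_fun measurableSet_Ioc fun x _ => ?_
  rw [intervalIntegral.integral_of_le (by norm_num)]

/-- The uniform measure on pairs of points of the unit square. -/
noncomputable def squarePair : Measure ((ℝ × ℝ) × (ℝ × ℝ)) :=
  (volume.restrict unitSquare).prod (volume.restrict unitSquare)

instance : IsProbabilityMeasure squarePair := by unfold squarePair; infer_instance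

theorem squarePair_eq : squarePair = volume.restrict (unitSquare ×ˢ unitSquare) := by
  rw [squarePair, Measure.prod_restrict, ← Measure.volume_eq_prod]

theorem ae_squarePair_mem : ∀ᵐ p ∂squarePair, p.1 ∈ unitSquare ∧ p.2 ∈ unitSquare := by
  rw [squarePair_eq]
  exact ae_restrict_mem (measurableSet_unitSquare.prod measurableSet_unitSquare)

theorem integrable_squarePair {f : (ℝ × ℝ) × (ℝ × ℝ) → ℝ} (hf : Continuous f) :
    Integrable f squarePair := by
  rw [squarePair_eq]
  have h : IsCompact unitSquare := isCompact_Icc.prod isCompact_Icc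
  exact hf.continuousOn.integrableOn_compact (h.prod h)

theorem integral_dotProd_unitSquare (u : ℝ × ℝ) : ∫ s in unitSquare, dotProd u s = 0 := by
  rw [integral_unitSquare (continuous_dotProd_left u)]
  simp only [dotProd]
  have : ∀ x : ℝ, ∫ y in (-(1 / 2) : ℝ)..1 / 2, (u.1 * x + u.2 * y) = u.1 * x := fun x => by
    rw [intervalIntegral.integral_add (by simp)
        ((continuous_const_mul u.2).intervalIntegrable _ _),
      intervalIntegral.integral_const_mul u.2, integral_id, intervalIntegral.integral_const,
      smul_eq_mul]
    ring
  simp only [this]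
  rw [intervalIntegral.integral_const_mul, integral_id]
  norm_num

/-- Fubini's theorem for the indicator of `r + m ≤ 0`. -/
theorem integral_integral_indicator {X : Type*} [MeasurableSpace X] (ν : Measure X)
    [IsProbabilityMeasure ν] {m : X → ℝ} (hm : Measurable m) {a : ℝ} (ha : 0 ≤ a)
    (hma : ∀ᵐ x ∂ν, |m x| ≤ a) :
    ∫ r in -a..a, ∫ x, (if r + m x ≤ 0 then (1 : ℝ) else 0) ∂ν = ∫ x, (a - m x) ∂ν := by
  rw [intervalIntegral.integral_of_le (by linarith), integral_integral_swap]
  · refine integral_congr_ae ?_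
    filter_upwards [hma] with x hx
    have e : (fun r => if r + m x ≤ 0 then (1 : ℝ) else 0) =
        (Iic (-m x)).indicator fun _ => (1 : ℝ) := by
      ext r
      simp only [indicator, mem_Iic]
      congr 1
      rw [eq_iff_iff]
      constructor <;> intro h <;> linarith
    -- For fixed `x` the admissible `r` form the interval `(-a, -m x]`, of length `a - m x` because
    -- `|m x| ≤ a`.
    rw [abs_le] at hx
    rw [e, integral_indicator measurableSet_Iic, Measure.restrict_restrict measurableSet_Iic,
      setIntegral_const, inter_comm, Ioc_inter_Iic, min_eq_right (by linarith),
      Real.volume_real_Ioc_of_le (by linarith), smul_eq_mul]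
    ring
  · refine Integrable.of_bound (C := 1) ?_ (ae_of_all _ fun p => ?_)
    · refine (Measurable.ite ?_ measurable_const measurable_const).aestronglyMeasurable
      exact measurableSet_le (by fun_prop) measurable_const
    · simp only [Function.uncurry]
      split_ifs <;> simp

theorem halfArea_eq_integral_ite (r : ℝ) (u : ℝ × ℝ) :
    halfArea r u = ∫ s in unitSquare, (if r + dotProd u s ≤ 0 then (1 : ℝ) else 0) :=
  halfArea_eq_integral r u

theorem abs_dotProd_le_of_mem_unitSquare {u s : ℝ × ℝ} (hu : u ∈ planeCircle)
    (hs : s ∈ unitSquare) : |dotProd u s| ≤ 1 / Real.sqrt 2 :=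
  (abs_dotProd_le hu s).trans (euclLength_le_of_mem_unitSquare hs)

theorem integral_halfArea {u : ℝ × ℝ} (hu : u ∈ planeCircle) :
    ∫ r in -(1 / Real.sqrt 2)..1 / Real.sqrt 2, halfArea r u = 1 / Real.sqrt 2 := by
  simp only [halfArea_eq_integral_ite]
  rw [integral_integral_indicator _ (continuous_dotProd_left u).measurable (by positivity),
    integral_sub (integrable_const _), integral_dotProd_unitSquare]
  · simp
  · exact (continuous_dotProd_left u).continuousOn.integrableOn_compact
      (isCompact_Icc.prod isCompact_Icc)
  · filter_upwards [ae_restrict_mem measurableSet_unitSquare] with s hs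
    exact abs_dotProd_le_of_mem_unitSquare hu hs

/-- The square is the probability that both of two independent points satisfy `u · s ≤ -r`, a
condition on the maximum. The maximum is half the sum, of mean zero, plus half the absolute
difference. -/
theorem integral_halfArea_sq {u : ℝ × ℝ} (hu : u ∈ planeCircle) :
    ∫ r in -(1 / Real.sqrt 2)..1 / Real.sqrt 2, halfArea r u ^ 2 =
      1 / Real.sqrt 2 - 1 / 2 * ∫ p, |dotProd u p.1 - dotProd u p.2| ∂squarePair := by
  have hd := continuous_dotProd_left u
  have h1 : ∀ r, halfArea r u ^ 2 = ∫ p, (if r + max (dotProd u p.1) (dotProd u p.2) ≤ 0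
      then (1 : ℝ) else 0) ∂squarePair := by
    intro r
    rw [sq, halfArea_eq_integral_ite, ← integral_prod_mul, ← squarePair]
    congr 1
    ext p
    have : r + max (dotProd u p.1) (dotProd u p.2) ≤ 0 ↔
        r + dotProd u p.1 ≤ 0 ∧ r + dotProd u p.2 ≤ 0 := by
      rw [← max_add_add_left, max_le_iff]
    simp only [this]
    split_ifs <;> simp_all
  have hmax : ∀ p : (ℝ × ℝ) × (ℝ × ℝ), max (dotProd u p.1) (dotProd u p.2) =
      1 / 2 * dotProd u p.1 + 1 / 2 * dotProd u p.2 +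
        1 / 2 * |dotProd u p.1 - dotProd u p.2| := by
    intro p
    rcases le_total (dotProd u p.1) (dotProd u p.2) with h | h
    · rw [max_eq_right h, abs_of_nonpos (by linarith)]; ring
    · rw [max_eq_left h, abs_of_nonneg (by linarith)]; ring
  have i1 : Integrable (fun p : (ℝ × ℝ) × (ℝ × ℝ) => dotProd u p.1) squarePair :=
    integrable_squarePair (hd.comp continuous_fst)
  have i2 : Integrable (fun p : (ℝ × ℝ) × (ℝ × ℝ) => dotProd u p.2) squarePair :=
    integrable_squarePair (hd.comp continuous_snd)
  have i3 : Integrable (fun p : (ℝ × ℝ) × (ℝ × ℝ) => |dotProd u p.1 - dotProd u p.2|)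
      squarePair :=
    (i1.sub i2).abs
  have z1 : ∫ p : (ℝ × ℝ) × (ℝ × ℝ), dotProd u p.1 ∂squarePair = 0 := by
    rw [squarePair, integral_fun_fst, integral_dotProd_unitSquare, smul_zero]
  have z2 : ∫ p : (ℝ × ℝ) × (ℝ × ℝ), dotProd u p.2 ∂squarePair = 0 := by
    rw [squarePair, integral_fun_snd, integral_dotProd_unitSquare, smul_zero]
  simp only [h1]
  rw [integral_integral_indicator squarePair (by fun_prop) (by positivity)]
  · have j12 : Integrable (fun p : (ℝ × ℝ) × (ℝ × ℝ) => 1 / 2 * dotProd u p.1 +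
        1 / 2 * dotProd u p.2) squarePair := (i1.const_mul _).add (i2.const_mul _)
    have j3 := i3.const_mul (1 / 2)
    have j : Integrable (fun p : (ℝ × ℝ) × (ℝ × ℝ) => 1 / 2 * dotProd u p.1 +
        1 / 2 * dotProd u p.2 + 1 / 2 * |dotProd u p.1 - dotProd u p.2|) squarePair := j12.add j3
    simp only [hmax]
    rw [integral_sub (integrable_const _) j, integral_add j12 j3,
      integral_add (i1.const_mul _) (i2.const_mul _), integral_const_mul, integral_const_mul,
      integral_const_mul, z1, z2]
    simp
  · filter_upwards [ae_squarePair_mem] with p hp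
    have h2 := abs_le.mp (abs_dotProd_le_of_mem_unitSquare hu hp.1)
    have h3 := abs_le.mp (abs_dotProd_le_of_mem_unitSquare hu hp.2)
    rw [abs_le]
    exact ⟨h2.1.trans (le_max_left _ _), max_le h2.2 h3.2⟩

theorem integral_abs_dotProd_sub {c d : ℝ} (hc : c ≠ 0) (hd : d ≠ 0) :
    ∫ p, |dotProd (c, d) p.1 - dotProd (c, d) p.2| ∂squarePair =
      ((c + d) ^ 4 * |c + d| + (c - d) ^ 4 * |c - d| - 2 * (c ^ 4 * |c|) - 2 * (d ^ 4 * |d|)) /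
        (60 * (c ^ 2 * d ^ 2)) := by
  have hcont : Continuous fun p : (ℝ × ℝ) × (ℝ × ℝ) =>
      |dotProd (c, d) p.1 - dotProd (c, d) p.2| := by
    unfold dotProd; fun_prop
  have hint := integrable_squarePair hcont
  rw [squarePair] at hint ⊢
  rw [integral_prod _ hint, ← integral_abs_four hc hd]
  have h1 : ∀ s : ℝ × ℝ, ∫ t in unitSquare, |dotProd (c, d) s - dotProd (c, d) t| =
      ∫ x' in (-(1 / 2) : ℝ)..1 / 2, ∫ y' in (-(1 / 2) : ℝ)..1 / 2,
        |c * s.1 + d * s.2 - (c * x' + d * y')| := fun s => by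
    rw [integral_unitSquare (by unfold dotProd; fun_prop)]
    rfl
  simp only [h1]
  rw [integral_unitSquare]
  refine intervalIntegral.continuous_parametric_intervalIntegral_of_continuous' ?_ _ _
  simp only [Function.uncurry_def]
  refine intervalIntegral.continuous_parametric_intervalIntegral_of_continuous' ?_ _ _
  simp only [Function.uncurry_def]
  fun_prop

end SquareIntegrals

/-! ### Integration over the angle and the variance -/

section Variance

/-- The mean of `|c * (x - x') + d * (y - y')|` over the unit square, for `c` and `d` nonzero. -/
noncomputable def meanAbsDiff (c d : ℝ) : ℝ :=
  ((c + d) ^ 4 * |c + d| + (c - d) ^ 4 * |c - d| - 2 * (c ^ 4 * |c|) - 2 * (d ^ 4 * |d|)) /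
    (60 * (c ^ 2 * d ^ 2))

theorem meanAbsDiff_comm (c d : ℝ) : meanAbsDiff d c = meanAbsDiff c d := by
  rw [meanAbsDiff, meanAbsDiff, abs_sub_comm d c, add_comm d c]
  congr 1 <;> ring

theorem meanAbsDiff_neg_left (c d : ℝ) : meanAbsDiff (-c) d = meanAbsDiff c d := by
  rw [meanAbsDiff, meanAbsDiff, ← abs_neg (-c + d), ← abs_neg (-c - d), abs_neg c,
    show -(-c + d) = c - d by ring, show -(-c - d) = c + d by ring]
  congr 1 <;> ring

/-- All absolute values open, and the numerator becomes `20c³d² + 10cd⁴ - 2d⁵`. -/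
theorem meanAbsDiff_of_le {c d : ℝ} (hd : 0 < d) (h : d ≤ c) :
    meanAbsDiff c d = c / 3 + d ^ 2 / (6 * c) - d ^ 3 / (30 * c ^ 2) := by
  have hc : 0 < c := hd.trans_le h
  rw [meanAbsDiff, abs_of_pos hd, abs_of_pos hc, abs_of_pos (by linarith : 0 < c + d),
    abs_of_nonneg (by linarith : 0 ≤ c - d)]
  field_simp
  ring

/-- The closed formula divides by `cos θ` and `sin θ`, which vanish only at countably many angles.
-/
theorem integral_abs_dotProd_sub_circlePoint :
    ∀ᵐ θ, ∫ p, |dotProd (circlePoint θ) p.1 - dotProd (circlePoint θ) p.2| ∂squarePair =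
      meanAbsDiff (Real.cos θ) (Real.sin θ) := by
  have hc : (range fun n : ℤ => (n : ℝ) * Real.pi).Countable := countable_range _
  have hc' : (range fun n : ℤ => (2 * (n : ℝ) + 1) * Real.pi / 2).Countable := countable_range _
  filter_upwards [hc.ae_notMem volume, hc'.ae_notMem volume] with θ h1 h2
  refine integral_abs_dotProd_sub (fun h => h2 ?_) (fun h => h1 ?_)
  · obtain ⟨n, hn⟩ := Real.cos_eq_zero_iff.mp h
    exact ⟨n, hn.symm⟩
  · exact Real.sin_eq_zero_iff.mp h

theorem continuous_integral_abs_dotProd_sub :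
    Continuous fun θ => ∫ p, |dotProd (circlePoint θ) p.1 - dotProd (circlePoint θ) p.2|
      ∂squarePair := by
  have hc := continuous_circlePoint
  refine continuous_of_dominated (bound := fun _ => 2) ?_ ?_ (integrable_const _) ?_
  · intro θ
    exact Continuous.aestronglyMeasurable (by unfold dotProd; fun_prop)
  · intro θ
    filter_upwards [ae_squarePair_mem] with p hp
    have h1 := abs_dotProd_le_of_mem_unitSquare (circlePoint_mem_planeCircle θ) hp.1
    have h2 := abs_dotProd_le_of_mem_unitSquare (circlePoint_mem_planeCircle θ) hp.2
    have h3 := one_div_sqrt_two_le_one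
    rw [Real.norm_eq_abs, abs_abs]
    exact (abs_sub _ _).trans (by linarith)
  · refine ae_of_all _ fun p => ?_
    unfold dotProd; fun_prop

/-- Inherited from the continuous mean that the formula represents almost everywhere, so its default
values on the axes do not matter. -/
theorem intervalIntegrable_meanAbsDiff (a b : ℝ) :
    IntervalIntegrable (fun θ => meanAbsDiff (Real.cos θ) (Real.sin θ)) volume a b :=
  (continuous_integral_abs_dotProd_sub.intervalIntegrable a b).congr_ae
    (ae_restrict_of_ae integral_abs_dotProd_sub_circlePoint)

theorem integral_meanAbsDiff_octant :
    ∫ θ in (0 : ℝ)..Real.pi / 4, meanAbsDiff (Real.cos θ) (Real.sin θ) =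
      Real.sqrt 2 / 30 + Real.log (1 + Real.sqrt 2) / 6 + 1 / 15 := by
  have hpi := Real.pi_pos
  have hcos : ∀ θ ∈ Icc 0 (Real.pi / 4), 0 < Real.cos θ := fun θ hθ =>
    Real.cos_pos_of_mem_Ioo ⟨by linarith [hθ.1], by linarith [hθ.2]⟩
  have hsin : ∀ θ ∈ Icc 0 (Real.pi / 4), 0 ≤ Real.sin θ := fun θ hθ =>
    Real.sin_nonneg_of_nonneg_of_le_pi hθ.1 (by linarith [hθ.2])
  have hIcc : uIcc 0 (Real.pi / 4) = Icc 0 (Real.pi / 4) := uIcc_of_le (by linarith)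
  have hcongr : ∫ θ in (0 : ℝ)..Real.pi / 4, meanAbsDiff (Real.cos θ) (Real.sin θ) =
      ∫ θ in (0 : ℝ)..Real.pi / 4, (Real.cos θ / 3 + Real.sin θ ^ 2 / (6 * Real.cos θ) -
        Real.sin θ ^ 3 / (30 * Real.cos θ ^ 2)) := by
    rw [intervalIntegral.integral_of_le (by linarith), intervalIntegral.integral_of_le
      (by linarith)]
    refine setIntegral_congr_fun measurableSet_Ioc fun θ hθ => meanAbsDiff_of_le ?_ ?_
    · exact Real.sin_pos_of_pos_of_lt_pi hθ.1 (by linarith [hθ.2])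
    · rw [← Real.cos_pi_div_two_sub]
      exact Real.cos_le_cos_of_nonneg_of_le_pi hθ.1.le (by linarith [hθ.1])
        (by linarith [hθ.2])
  -- With `sin² = 1 - cos²` the integrand is `cos/6 + 1/(6 cos) - (sin/cos² - sin)/30`, integrated
  -- term by term.
  rw [hcongr, intervalIntegral.integral_eq_sub_of_hasDerivAt (f := fun θ => Real.sin θ / 6 +
    (Real.log (1 + Real.sin θ) - Real.log (Real.cos θ)) / 6 -
      ((Real.cos θ)⁻¹ + Real.cos θ) / 30)]
  · have hs : Real.sqrt 2 * Real.sqrt 2 = 2 := Real.mul_self_sqrt (by norm_num)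
    have hs0 : 0 < Real.sqrt 2 := by positivity
    have hlog : Real.log (1 + Real.sqrt 2 / 2) - Real.log (Real.sqrt 2 / 2) =
        Real.log (1 + Real.sqrt 2) := by
      rw [← Real.log_div (by positivity) (by positivity)]
      congr 1
      field_simp
      nlinarith
    have hinv : (Real.sqrt 2 / 2)⁻¹ = Real.sqrt 2 := by
      field_simp
      nlinarith
    simp only [Real.sin_pi_div_four, Real.cos_pi_div_four, Real.sin_zero, Real.cos_zero, hlog, hinv]
    simp
    ring
  · intro θ hθ
    rw [hIcc] at hθ
    have h1 := hcos θ hθ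
    have h2 := hsin θ hθ
    have h3 := Real.sin_sq_add_cos_sq θ
    have d1 := Real.hasDerivAt_sin θ
    have d2 := Real.hasDerivAt_cos θ
    have d3 := (d1.const_add 1).log (by linarith)
    have d4 := d2.log h1.ne'
    have d5 := d2.fun_inv h1.ne'
    refine (((d1.div_const 6).add ((d3.sub d4).div_const 6)).sub
      ((d5.add d2).div_const 30)).congr_deriv ?_
    have h4 : Real.cos θ / (1 + Real.sin θ) = (1 - Real.sin θ) / Real.cos θ := by
      rw [div_eq_div_iff (by linarith) h1.ne']
      nlinarith
    rw [h4]
    have h5 : Real.sin θ ^ 3 = Real.sin θ * (1 - Real.cos θ ^ 2) := by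
      rw [← h3]; ring
    have h6 : Real.sin θ ^ 2 = 1 - Real.cos θ ^ 2 := by rw [← h3]; ring
    rw [h5, h6]
    field_simp
    ring
  · refine ContinuousOn.intervalIntegrable ?_
    rw [hIcc]
    refine ContinuousOn.sub (ContinuousOn.add (by fun_prop) ?_) ?_
    · exact ContinuousOn.div (by fun_prop) (by fun_prop) fun θ hθ => by
        have := hcos θ hθ; positivity
    · exact ContinuousOn.div (by fun_prop) (by fun_prop) fun θ hθ => by
        have := hcos θ hθ; positivity

/-- Symmetry in sign and in the exchange of coordinates gives period `π/2` and the reflection `θ ↦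
π/2 - θ`, so the circle consists of eight equal octants. -/
theorem integral_meanAbsDiff :
    ∫ θ in -Real.pi..Real.pi, meanAbsDiff (Real.cos θ) (Real.sin θ) =
      8 * (Real.sqrt 2 / 30 + Real.log (1 + Real.sqrt 2) / 6 + 1 / 15) := by
  have hper : Function.Periodic (fun θ => meanAbsDiff (Real.cos θ) (Real.sin θ))
      (Real.pi / 2) := fun θ => by
    simp only [Real.cos_add_pi_div_two, Real.sin_add_pi_div_two]
    rw [meanAbsDiff_neg_left, meanAbsDiff_comm]
  have h1 := hper.intervalIntegral_add_zsmul_eq 4 (-Real.pi)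
    intervalIntegrable_meanAbsDiff
  have h2 := hper.intervalIntegral_add_eq (-Real.pi) 0
  have h3 : ∫ θ in Real.pi / 4..Real.pi / 2, meanAbsDiff (Real.cos θ) (Real.sin θ) =
      ∫ θ in (0 : ℝ)..Real.pi / 4, meanAbsDiff (Real.cos θ) (Real.sin θ) := by
    have := intervalIntegral.integral_comp_sub_left (a := 0) (b := Real.pi / 4)
      (fun θ => meanAbsDiff (Real.cos θ) (Real.sin θ)) (Real.pi / 2)
    simp only [Real.cos_pi_div_two_sub, Real.sin_pi_div_two_sub, sub_zero,
      show Real.pi / 2 - Real.pi / 4 = Real.pi / 4 by ring] at this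
    rw [← this]
    exact intervalIntegral.integral_congr fun θ _ => meanAbsDiff_comm _ _
  have h4 := intervalIntegral.integral_add_adjacent_intervals
    (intervalIntegrable_meanAbsDiff 0 (Real.pi / 4))
    (intervalIntegrable_meanAbsDiff (Real.pi / 4) (Real.pi / 2))
  rw [show -Real.pi + (4 : ℤ) • (Real.pi / 2) = Real.pi by
    rw [zsmul_eq_mul]; push_cast; ring, h2] at h1
  rw [h1, zero_add, ← h4, h3, integral_meanAbsDiff_octant, zsmul_eq_mul]
  push_cast; ring

theorem integral_paramUniform_areaLeft {φ : ℝ → ℝ} (hφ : Continuous φ) :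
    ∫ q, φ (areaLeft q) ∂paramUniform = (volume.real paramRect)⁻¹ *
      ∫ θ in -Real.pi..Real.pi, ∫ r in -(1 / Real.sqrt 2)..1 / Real.sqrt 2,
        φ (halfArea r (circlePoint θ)) := by
  have hpi := Real.pi_pos
  have h0 : -(1 / Real.sqrt 2) ≤ 1 / Real.sqrt 2 := by
    have : 0 < 1 / Real.sqrt 2 := by positivity
    linarith
  have hc : Continuous fun q => φ (areaLeft q) := hφ.comp continuous_areaLeft
  have hi : IntegrableOn (fun q => φ (areaLeft q))
      (Ioo (-(1 / Real.sqrt 2)) (1 / Real.sqrt 2) ×ˢ Ioo (-Real.pi) Real.pi) :=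
    (hc.continuousOn.integrableOn_compact (isCompact_Icc.prod isCompact_Icc)).mono_set
      (prod_mono Ioo_subset_Icc_self Ioo_subset_Icc_self)
  rw [integral_paramUniform hc fun r => (areaLeft_periodic r).comp φ]
  congr 1
  rw [Measure.volume_eq_prod, ← setIntegral_prod_swap, setIntegral_prod]
  · rw [intervalIntegral.integral_of_le (by linarith), integral_Ioc_eq_integral_Ioo]
    refine setIntegral_congr_fun measurableSet_Ioo fun θ _ => ?_
    rw [intervalIntegral.integral_of_le h0, integral_Ioc_eq_integral_Ioo]
    simp only [Prod.swap_prod_mk, areaLeft_eq_halfArea]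
  · rw [IntegrableOn, ← Measure.prod_restrict]
    rw [IntegrableOn, Measure.volume_eq_prod, ← Measure.prod_restrict] at hi
    exact hi.swap

theorem integral_areaLeft : ∫ q, areaLeft q ∂paramUniform = 1 / 2 := by
  have hpi := Real.pi_pos
  have h := integral_paramUniform_areaLeft continuous_id
  simp only [id] at h
  rw [h, intervalIntegral.integral_congr fun θ _ =>
    integral_halfArea (circlePoint_mem_planeCircle θ), intervalIntegral.integral_const,
    volume_real_paramRect, smul_eq_mul]
  field_simp
  ring

theorem integral_areaLeft_sq :
    ∫ q, areaLeft q ^ 2 ∂paramUniform = 1 / 2 - Real.sqrt 2 / Real.pi *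
      (Real.sqrt 2 / 30 + Real.log (1 + Real.sqrt 2) / 6 + 1 / 15) := by
  have hpi := Real.pi_pos
  rw [integral_paramUniform_areaLeft (φ := fun x => x ^ 2) (by fun_prop),
    intervalIntegral.integral_congr fun θ _ =>
      integral_halfArea_sq (circlePoint_mem_planeCircle θ),
    intervalIntegral.integral_sub (by simp)
      ((continuous_integral_abs_dotProd_sub.const_mul _).intervalIntegrable _ _),
    intervalIntegral.integral_const, intervalIntegral.integral_const_mul,
    intervalIntegral.integral_congr_ae (integral_abs_dotProd_sub_circlePoint.mono fun θ h _ => h),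
    integral_meanAbsDiff, volume_real_paramRect, smul_eq_mul]
  field_simp
  ring

theorem variance_areaLeft : variance areaLeft paramUniform = limitVariance := by
  have hpi := Real.pi_pos
  have hs : Real.sqrt 2 ^ 2 = 2 := Real.sq_sqrt (by norm_num)
  have hs3 : Real.sqrt 2 ^ 3 = 2 * Real.sqrt 2 := by rw [pow_succ, hs]
  have hL : MemLp areaLeft 2 paramUniform := by
    refine MemLp.of_bound continuous_areaLeft.aestronglyMeasurable 1 (ae_of_all _ fun q => ?_)
    have := halfArea_mem_Icc q.1 (circlePoint q.2)
    rw [← areaLeft_eq_halfArea] at this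
    rw [Real.norm_eq_abs, abs_of_nonneg this.1]
    exact this.2
  rw [variance_eq_sub hL]
  simp only [Pi.pow_apply]
  rw [integral_areaLeft, integral_areaLeft_sq, limitVariance]
  field_simp
  ring_nf
  rw [hs, hs3]
  ring

end Variance

theorem mainTheorem2 :
    TendstoInDistribution (fun R : Set.Ioi (0 : ℝ) => areaInDisc (R : ℝ)) atTop areaLeft
      latticeUniform paramUniform ∧
    variance areaLeft paramUniform = limitVariance :=
  ⟨tendstoInDistribution_areaInDisc, variance_areaLeft⟩
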